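/- For a complex Lie algebra $\mathcal L$ of finite dimension put $(\psi\mathcal L)(\alpha)=\dim\{A\in\operatorname{End}\mathcal L : \alpha A[x,y]=[Ax,y]+[x,Ay]\ \text{for all } x,y\in\mathcal L\}$, and let $(\phi\mathcal L)(\alpha)$ be the dimension of the space of alternating bilinear maps $B:\mathcal L\times\mathcal L\to\mathcal L$ such that for all $x,y,z\in\mathcal L$ $$0=B(x,[y,z])+B(z,[x,y])+B(y,[z,x])+\alpha[x,B(y,z)]+\alpha[z,B(x,y)]+\alpha[y,B(z,x)]\qquad(\alpha\in\mathbb C).$$ For $a\in\mathbb C$, let $\mathcal L_{17,7}(a)$ be the complex Lie algebra with basis $(l_{01},l_{02},l_{10},l_{20},l_{11},l_{22},l_{12},l_{21})$ whose brackets of basis vectors, up to antisymmetry, are $$[l_{01},l_{10}]=-a\,l_{11},\ [l_{01},l_{20}]=l_{21},\ [l_{01},l_{11}]=l_{12},\ [l_{01},l_{22}]=l_{20},\ [l_{02},l_{10}]=l_{12},\ [l_{02},l_{22}]=l_{21},\ [l_{10},l_{11}]=l_{21},$$ all others being zero. 1. For every $a\neq0$, $\mathcal L_{17,7}(a)$ is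 an eight-dimensional nilpotent Lie algebra and, with the line $\mathbb C\,l_{rs}$ in degree $(r,s)\in\mathbb Z_3\times\mathbb Z_3$, it is a graded contraction of the Pauli graded $\mathrm{sl}(3,\mathbb C)$: with $Q=\operatorname{diag}(1,\omega,\omega^2)$, $\omega=e^{2\pi i/3}$, and $P$ the cyclic shift matrix, there are a symmetric matrix $\varepsilon$ indexed by $\mathbb Z_3\times\mathbb Z_3$ and a linear isomorphism $e:\mathrm{sl}(3,\mathbb C)\to\mathcal L_{17,7}(a)$ that maps each line $\mathbb C\,Q^rP^s$, $(r,s)\ne(0,0)$, onto $\mathbb C\,l_{rs}$ and satisfies $[e(x),e(y)]=\varepsilon_{jk}\,e([x,y])$ for $x,y$ homogeneous of degrees $j,k$. 2. For every $a\neq 0$: $(\psi\mathcal L_{17,7}(a))(0)=20$, $(\psi\mathcal L_{17,7}(a))(1)=19$, and $(\psi\mathcal L_{17,7}(a))(\alpha)=18$ for all other $\alpha$. In particular $\psi\mathcal L_{17,7}(a)$ does not depend on $a\ne0$. 3. The function $\phi_a=\phi\mathcal L_{17,7}(a)$, $a\ne0$, is as follows, and it equals $80$ at every $\alpha$ not listed: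 - $a=1$: $\phi_a(0)=112$, $\phi_a(1)=83$, $\phi_a(-1)=81$; - $a=-1$: $\phi_a(0)=104$, $\phi_a(1)=83$, $\phi_a(-1)=81$; - $a=\frac14\pm\frac{\sqrt7}{4}i$: $\phi_a(0)=104$, $\phi_a(1)=82$, $\phi_a(-a)=82$; - $a=\frac13$: $\phi_a(0)=104$, $\phi_a(1)=83$, $\phi_a(-\frac13)=81$; - all other $a\ne0$: $\phi_a(0)=104$, $\phi_a(1)=82$, $\phi_a(-a)=81$, $\phi_a(-\frac12+\frac1{2a})=81$. 4. If $a,a'\neq0$ and $\phi\mathcal L_{17,7}(a)=\phi\mathcal L_{17,7}(a')$ (as functions on $\mathbb C$), then $a=a'$. Consequently, for $a,a'\ne0$, if $\mathcal L_{17,7}(a)$ and $\mathcal L_{17,7}(a')$ are isomorphic as complex Lie algebras, then $a=a'$. -/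

import Mathlib

/-! ### Twisted cocycles of the adjoint representation and the invariant functions `ψ`, `φ` -/

section Invariants

variable (L : Type*) [LieRing L] [LieAlgebra ℂ L]

/-- The space of `(α, β, γ)`-derivations of a complex Lie algebra `L`: the linear operators `A` with
`α A[x,y] = β [Ax,y] + γ [x,Ay]`. -/
def genDer (α β γ : ℂ) : Submodule ℂ (L →ₗ[ℂ] L) where
  carrier := {A | ∀ x y : L, α • A ⁅x, y⁆ = β • ⁅A x, y⁆ + γ • ⁅x, A y⁆}
  zero_mem' := by intro x y; simp
  add_mem' := by
    intro A B hA hB x y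
    simp only [LinearMap.add_apply, add_lie, lie_add, smul_add, hA x y, hB x y]
    abel
  smul_mem' := by
    intro c A hA x y
    simp only [LinearMap.smul_apply, smul_lie, lie_smul]
    rw [smul_comm α c, hA x y, smul_add, smul_comm c β, smul_comm c γ]

/-- The invariant function `ψ L`: `(ψ L)(α)` is the dimension of the space of
`(α, 1, 1)`-derivations. -/
noncomputable def invPsi (α : ℂ) : ℕ := Module.finrank ℂ (genDer L α 1 1)

/-- The space of two-dimensional twisted cocycles of the adjoint representation of `L` with
parameters `α₁, α₂, α₃, β₁, β₂, β₃`: the alternating bilinear maps `B : L × L → L` with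
`0 = α₁ B(x,[y,z]) + α₂ B(z,[x,y]) + α₃ B(y,[z,x]) + β₁ [x,B(y,z)] + β₂ [z,B(x,y)] + β₃ [y,B(z,x)]`
(that is, the `κ`-twisted cocycles for the symmetric matrix
`κ = !![β₁, α₂, α₃; α₂, β₃, α₁; α₃, α₁, β₂]`). -/
def twistedCocycle (α₁ α₂ α₃ β₁ β₂ β₃ : ℂ) :
    Submodule ℂ (LieModule.Cohomology.twoCochain ℂ L L) where
  carrier := {B | ∀ x y z : L,
    0 = α₁ • B x ⁅y, z⁆ + α₂ • B z ⁅x, y⁆ + α₃ • B y ⁅z, x⁆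
      + β₁ • ⁅x, B y z⁆ + β₂ • ⁅z, B x y⁆ + β₃ • ⁅y, B z x⁆}
  zero_mem' := by
    intro x y z
    have h : ∀ u v : L, (0 : LieModule.Cohomology.twoCochain ℂ L L) u v = 0 := fun _ _ => rfl
    simp [h]
  add_mem' := by
    intro B C hB hC x y z
    simp only [LieModule.Cohomology.add_apply_apply, lie_add, smul_add]
    have h := congrArg₂ (· + ·) (hB x y z) (hC x y z)
    simp only [add_zero] at h
    rw [h]
    abel
  smul_mem' := by
    intro c B hB x y z
    simp only [LieModule.Cohomology.smul_apply_apply, lie_smul]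
    have h := congrArg (c • ·) (hB x y z)
    simp only [smul_zero, smul_add] at h
    rw [h]
    simp only [smul_comm c]

/-- The invariant function `φ L`: `(φ L)(α)` is the dimension of the space of two-dimensional
twisted cocycles with parameters `1, 1, 1, α, α, α`. -/
noncomputable def invPhi (α : ℂ) : ℕ := Module.finrank ℂ (twistedCocycle L 1 1 1 α α α)

end Invariants

/-! ### The Pauli grading of `sl(3, ℂ)` and its graded contractions -/

section Pauli

attribute [local instance 100] LieRing.ofAssociativeRing

/-- The grading group `ℤ₃ × ℤ₃`. -/
abbrev PauliIndex : Type := ZMod 3 × ZMod 3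

/-- The primitive third root of unity `ω = exp(2πi/3)`. -/
noncomputable def pauliOmega : ℂ := Complex.exp (2 * Real.pi * Complex.I / 3)

/-- The generalized Pauli matrix `Q = diag(1, ω, ω²)`. -/
noncomputable def pauliQ : Matrix (Fin 3) (Fin 3) ℂ :=
  Matrix.diagonal ![1, pauliOmega, pauliOmega ^ 2]

/-- The generalized Pauli matrix `P`, the cyclic shift. -/
def pauliP : Matrix (Fin 3) (Fin 3) ℂ := !![0, 1, 0; 0, 0, 1; 1, 0, 0]

/-- The homogeneous component of degree `(r, s)` of the Pauli grading of `sl(3, ℂ)`: the traceless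
multiples of `Q ^ r * P ^ s`. It is a line for `(r, s) ≠ (0, 0)`, and zero for `(r, s) = (0, 0)`. -/
noncomputable def pauliComponent (k : PauliIndex) :
    Submodule ℂ (LieAlgebra.SpecialLinear.sl (Fin 3) ℂ) :=
  (Submodule.span ℂ {pauliQ ^ k.1.val * pauliP ^ k.2.val}).comap
    (LieAlgebra.SpecialLinear.sl (Fin 3) ℂ).toSubmodule.subtype

/-- A Lie algebra `L` together with subspaces `Lₖ` is (up to graded isomorphism) a graded contraction
of the Pauli graded `sl(3, ℂ)`: there are a symmetric matrix `ε` of contraction parameters and a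
linear isomorphism `e : sl(3, ℂ) → L` which maps each component of the Pauli grading onto the
corresponding `Lₖ` and satisfies `[e x, e y] = ε_{jk} e [x, y]` for homogeneous `x`, `y` of degrees
`j`, `k`. -/
def IsPauliGradedContraction (L : Type*) [LieRing L] [LieAlgebra ℂ L]
    (comp : PauliIndex → Submodule ℂ L) : Prop :=
  ∃ (ε : PauliIndex → PauliIndex → ℂ) (e : LieAlgebra.SpecialLinear.sl (Fin 3) ℂ ≃ₗ[ℂ] L),
    (∀ j k, ε j k = ε k j) ∧
    (∀ k, (pauliComponent k).map (e : LieAlgebra.SpecialLinear.sl (Fin 3) ℂ →ₗ[ℂ] L) = comp k) ∧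
    ∀ j k, ∀ x ∈ pauliComponent j, ∀ y ∈ pauliComponent k, ⁅e x, e y⁆ = ε j k • e ⁅x, y⁆

end Pauli

/-! ### The Lie algebras `𝓛₁₇,₇(a)` -/

/-- The underlying space of `𝓛₁₇,₇(a)`: coordinate vectors with respect to the ordered basis
`(l₀₁, l₀₂, l₁₀, l₂₀, l₁₁, l₂₂, l₁₂, l₂₁)`. -/
def L177 (_a : ℂ) : Type := Fin 8 → ℂ

namespace L177

variable (a : ℂ)

noncomputable instance : AddCommGroup (L177 a) := inferInstanceAs (AddCommGroup (Fin 8 → ℂ))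

noncomputable instance : Module ℂ (L177 a) := inferInstanceAs (Module ℂ (Fin 8 → ℂ))

/-- The basis vectors `l₀₁, l₀₂, l₁₀, l₂₀, l₁₁, l₂₂, l₁₂, l₂₁`, numbered from `0` to `7`. -/
noncomputable def basisVec (i : Fin 8) : L177 a := (Pi.single i 1 : Fin 8 → ℂ)

/-- The labels in `ℤ₃ × ℤ₃` of the basis vectors. -/
def label : Fin 8 → PauliIndex :=
  ![(0, 1), (0, 2), (1, 0), (2, 0), (1, 1), (2, 2), (1, 2), (2, 1)]

/-- The component of degree `k` : the line through the basis vector with label `k`, and zero for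
`k = (0, 0)`. -/
noncomputable def component (k : PauliIndex) : Submodule ℂ (L177 a) :=
  Submodule.span ℂ {v | ∃ i, label i = k ∧ v = basisVec a i}

/-- The `2 × 2` minor `xᵢ yⱼ - xⱼ yᵢ` of two coordinate vectors. -/
def minor (x y : Fin 8 → ℂ) (i j : Fin 8) : ℂ := x i * y j - x j * y i

/-- The bracket with the non-zero commutation relations
`[l₀₁,l₁₀] = -a l₁₁`, `[l₀₁,l₂₀] = l₂₁`, `[l₀₁,l₁₁] = l₁₂`, `[l₀₁,l₂₂] = l₂₀`,
`[l₀₂,l₁₀] = l₁₂`, `[l₀₂,l₂₂] = l₂₁`, `[l₁₀,l₁₁] = l₂₁`. -/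
def bracket (x y : Fin 8 → ℂ) : Fin 8 → ℂ :=
  ![0, 0, 0,
    minor x y 0 5,
    -a * minor x y 0 2,
    0,
    minor x y 0 4 + minor x y 1 2,
    minor x y 0 3 + minor x y 1 5 + minor x y 2 4]

theorem bracket_add_left (x y z : Fin 8 → ℂ) :
    bracket a (x + y) z = bracket a x z + bracket a y z := by
  funext i
  fin_cases i <;> simp [bracket, minor] <;> ring

theorem bracket_skew (x y : Fin 8 → ℂ) : bracket a x y = -bracket a y x := by
  funext i
  fin_cases i <;> simp [bracket, minor] <;> ring

theorem bracket_self (x : Fin 8 → ℂ) : bracket a x x = 0 := by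
  funext i
  fin_cases i <;> simp [bracket, minor, mul_comm]

theorem bracket_add_right (x y z : Fin 8 → ℂ) :
    bracket a x (y + z) = bracket a x y + bracket a x z := by
  rw [bracket_skew a x, bracket_add_left, bracket_skew a x y, bracket_skew a x z, neg_add]

theorem bracket_smul_right (t : ℂ) (x y : Fin 8 → ℂ) :
    bracket a x (t • y) = t • bracket a x y := by
  funext i
  fin_cases i <;> simp [bracket, minor] <;> ring

theorem bracket_leibniz (x y z : Fin 8 → ℂ) :
    bracket a x (bracket a y z) = bracket a (bracket a x y) z + bracket a y (bracket a x z) := by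
  funext i
  fin_cases i <;> simp [bracket, minor] <;> ring

noncomputable instance : LieRing (L177 a) where
  bracket x y := (bracket a x y : Fin 8 → ℂ)
  add_lie := bracket_add_left a
  lie_add := bracket_add_right a
  lie_self := bracket_self a
  leibniz_lie := bracket_leibniz a

noncomputable instance : LieAlgebra ℂ (L177 a) where
  lie_smul := bracket_smul_right a

end L177

/-!
All spaces in question are solution spaces of explicit systems of linear equations, and their
dimensions are found by exhibiting coordinate systems on them
(`finrank_eq_card_of_functionals`): a finite family of linear functionals that has no common zero but `0`
on the space and takes all systems of values on it.

**The function `φ`.** An alternating bilinear map `B` is given by the coordinates of the vectors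
`B(lᵢ, lⱼ)`, `i < j`, and the defect of the twisted cocycle identity is alternating, so that it has
to vanish on increasing triples of basis vectors only (`mem_twistedCocycle_iff_basis`). For `t ≠ 0`
the system is homogeneous for a grading of the Lie algebra by `ℤ × ℤ`, and it splits into small
blocks. All blocks have a rank that does not depend on `a ≠ 0` and `t ≠ 0`, except that a coordinate
is killed by each of the factors `t + a` and `2 a t - (1 - a)`, that one is killed by `t - 1` and
`a - 1` together, and that two further ones are killed by `t - 1`. This is expressed by
`eq_zero_of_free_eq_zero` (the functionals separate cocycles) and `coordDefect_cocycleTable` (all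
values occur), and gives `invPhi_of_ne_zero`: the value is `80`, plus `1` if `t = -a`, plus `1` if
`2 a t = 1 - a`, plus `2` if `t = 1`, plus `1` if `t = a = 1`. For `t = 0` the brackets with values
of `B` drop out of the identity, each coordinate of `B` is a scalar cocycle, and `invPhi_zero` gives
eight times the dimension `13`, or `14` if `a = 1`, of the space of scalar cocycles.

**The function `ψ`.** The same method, with the identities on pairs of basis vectors, gives
`invPsi_eq`.

**Isomorphisms.** The function `φ` is an isomorphism invariant (`invPhi_eq_of_equiv`), and it
determines `a` (`invPhi_injective`): it shows the pair of the exceptional arguments `-a` and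
`(1 - a) / (2 a)`, whose product is `-(1 - a) / 2`.

**The contraction.** In the basis `Q ^ r * P ^ s` of `sl(3, ℂ)` the commutation relations are
`[Q ^ r P ^ s, Q ^ r' P ^ s'] = (ω ^ (s r') - ω ^ (s' r)) Q ^ (r + r') P ^ (s + s')`, by
`P Q = ω Q P`. Each non-zero bracket of basis vectors of `𝓛₁₇,₇(a)` has degree `(r + r', s + s')`,
and the corresponding coefficient of `sl(3, ℂ)` is not zero; the contraction parameters are the
quotients of the structure constants. Nilpotency follows from `(ad x) ^ 3 = 0` by Engel's theorem.
-/

/-! ### Dimension counts and reduction to a basis -/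

/-- If the functionals `φ i`, `i ∈ s`, separate the points of a subspace `V` and take all systems of
values on it, then the dimension of `V` is the number of these functionals. -/
theorem finrank_eq_card_of_functionals {ι M : Type*} [AddCommGroup M] [Module ℂ M]
    (V : Submodule ℂ M) (φ : ι → M →ₗ[ℂ] ℂ) (s : Finset ι)
    (hinj : ∀ v ∈ V, (∀ i ∈ s, φ i v = 0) → v = 0)
    (hsurj : ∀ z : ι → ℂ, (∀ i ∉ s, z i = 0) → ∃ v ∈ V, ∀ i ∈ s, φ i v = z i) :
    Module.finrank ℂ V = s.card := by
  classical
  let Φ : V →ₗ[ℂ] (s → ℂ) := LinearMap.pi fun i => (φ i).comp V.subtype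
  have hΦ : Function.Bijective Φ := by
    constructor
    · rw [injective_iff_map_eq_zero]
      intro v hv
      exact Subtype.ext (hinj v v.2 fun i hi => congrFun hv ⟨i, hi⟩)
    · intro z
      obtain ⟨v, hv, h⟩ := hsurj (fun i => if hi : i ∈ s then z ⟨i, hi⟩ else 0)
        (fun i hi => by simp [hi])
      refine ⟨⟨v, hv⟩, ?_⟩
      ext i
      exact (h i i.2).trans (by simp)
  rw [(LinearEquiv.ofBijective Φ hΦ).finrank_eq]
  simp

section Reduction

variable {L : Type*} [LieRing L] [LieAlgebra ℂ L]

/-- The defect of the twisted cocycle identity with parameters `1, 1, 1, α, α, α`. -/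
def twistedDefect (α : ℂ) (B : LieModule.Cohomology.twoCochain ℂ L L) (x y z : L) : L :=
  B x ⁅y, z⁆ + B z ⁅x, y⁆ + B y ⁅z, x⁆ + α • ⁅x, B y z⁆ + α • ⁅z, B x y⁆ + α • ⁅y, B z x⁆

variable (α : ℂ) (B : LieModule.Cohomology.twoCochain ℂ L L)

theorem mem_twistedCocycle_iff_defect :
    B ∈ twistedCocycle L 1 1 1 α α α ↔ ∀ x y z, twistedDefect α B x y z = 0 := by
  change (∀ x y z : L, 0 = _) ↔ _
  simp only [one_smul, twistedDefect, eq_comm]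

theorem twistedDefect_rotate (x y z : L) :
    twistedDefect α B x y z = twistedDefect α B y z x := by
  simp only [twistedDefect]
  abel

theorem twistedDefect_swap (x y z : L) :
    twistedDefect α B x y z = -twistedDefect α B y x z := by
  have h := LieModule.Cohomology.twoCochain_skew B
  have hl : ∀ u v w : L, B u ⁅v, w⁆ = - B u ⁅w, v⁆ := fun u v w => by rw [← lie_skew, map_neg]
  simp only [twistedDefect]
  rw [hl x y z, hl z x y, hl y z x, ← h z y, ← h y x, ← h x z]
  simp only [lie_neg, smul_neg]
  abel

theorem twistedDefect_self (x z : L) : twistedDefect α B x x z = 0 := by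
  have h := twistedDefect_swap α B x x z
  rw [eq_neg_iff_add_eq_zero, ← two_smul ℂ] at h
  exact (smul_eq_zero.mp h).resolve_left two_ne_zero

theorem twistedDefect_add (x x' y z : L) : twistedDefect α B (x + x') y z =
    twistedDefect α B x y z + twistedDefect α B x' y z := by
  simp only [twistedDefect, map_add, LinearMap.add_apply, add_lie, lie_add, smul_add]
  abel

theorem twistedDefect_smul (c : ℂ) (x y z : L) : twistedDefect α B (c • x) y z =
    c • twistedDefect α B x y z := by
  simp only [twistedDefect, map_smul, LinearMap.smul_apply, smul_lie, lie_smul, smul_add,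
    smul_comm c α]

theorem twistedDefect_eq_zero_of_basis {ι : Type*} (e : Module.Basis ι ℂ L) {y z : L}
    (h : ∀ i, twistedDefect α B (e i) y z = 0) (x : L) : twistedDefect α B x y z = 0 := by
  refine Submodule.span_induction (p := fun x _ => twistedDefect α B x y z = 0) ?_ ?_ ?_ ?_
    (e.mem_span x)
  · rintro _ ⟨i, rfl⟩
    exact h i
  · simpa using twistedDefect_smul α B 0 0 y z
  · intro u v _ _ hu hv
    rw [twistedDefect_add, hu, hv, add_zero]
  · intro c u _ hu
    rw [twistedDefect_smul, hu, smul_zero]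

/-- The twisted cocycle identity is alternating in its three arguments, so that it need only be
checked on increasing triples of basis vectors. -/
theorem mem_twistedCocycle_iff_basis {ι : Type*} [LinearOrder ι] (e : Module.Basis ι ℂ L) :
    B ∈ twistedCocycle L 1 1 1 α α α ↔
      ∀ i j k, i < j → j < k → twistedDefect α B (e i) (e j) (e k) = 0 := by
  rw [mem_twistedCocycle_iff_defect]
  refine ⟨fun h i j k _ _ => h _ _ _, fun h => ?_⟩
  have key : ∀ i j k, i ≤ j → i ≤ k → twistedDefect α B (e i) (e j) (e k) = 0 := by
    intro i j k hij hik
    rcases hij.eq_or_lt with rfl | hij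
    · exact twistedDefect_self α B _ _
    rcases hik.eq_or_lt with rfl | hik
    · rw [twistedDefect_rotate, twistedDefect_rotate, twistedDefect_self]
    rcases lt_trichotomy j k with hjk | rfl | hjk
    · exact h i j k hij hjk
    · rw [twistedDefect_rotate, twistedDefect_self]
    · rw [twistedDefect_swap, twistedDefect_rotate, h i k j hik hjk, neg_zero]
  have basis : ∀ i j k, twistedDefect α B (e i) (e j) (e k) = 0 := by
    intro i j k
    rcases le_total i j with hij | hij <;> rcases le_total i k with hik | hik
    · exact key i j k hij hik
    · rw [twistedDefect_rotate, twistedDefect_rotate]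
      exact key k i j hik (hik.trans hij)
    · rw [twistedDefect_rotate]
      exact key j k i (hij.trans hik) hij
    · rw [twistedDefect_rotate]
      rcases le_total j k with hjk | hjk
      · exact key j k i hjk hij
      · rw [twistedDefect_rotate]
        exact key k i j hik hjk
  intro x y z
  refine twistedDefect_eq_zero_of_basis α B e (fun i => ?_) x
  rw [twistedDefect_rotate]
  refine twistedDefect_eq_zero_of_basis α B e (fun j => ?_) y
  rw [twistedDefect_rotate]
  exact twistedDefect_eq_zero_of_basis α B e (fun k => by
    rw [twistedDefect_rotate]; exact basis i j k) z

/-- The identity that defines `(α, 1, 1)`-derivations is alternating in its two arguments, so that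
it need only be checked on increasing pairs of basis vectors. -/
theorem mem_genDer_iff_basis {ι : Type*} [LinearOrder ι] (e : Module.Basis ι ℂ L)
    (A : L →ₗ[ℂ] L) :
    A ∈ genDer L α 1 1 ↔
      ∀ i j, i < j → α • A ⁅e i, e j⁆ - (⁅A (e i), e j⁆ + ⁅e i, A (e j)⁆) = 0 := by
  change (∀ x y : L, _ = _) ↔ _
  simp only [one_smul]
  refine ⟨fun h i j _ => sub_eq_zero.mpr (h _ _), fun h => ?_⟩
  let D : L →ₗ[ℂ] L →ₗ[ℂ] L := LinearMap.mk₂ ℂ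
    (fun x y => α • A ⁅x, y⁆ - (⁅A x, y⁆ + ⁅x, A y⁆))
    (by intros; simp only [add_lie, map_add, smul_add]; abel)
    (by intros; simp only [smul_lie, map_smul, smul_sub, smul_add, smul_comm α])
    (by intros; simp only [lie_add, map_add, smul_add]; abel)
    (by intros; simp only [lie_smul, map_smul, smul_sub, smul_add, smul_comm α])
  have hself : ∀ x, D x x = 0 := by
    intro x
    simp only [D, LinearMap.mk₂_apply, lie_self, map_zero, smul_zero, zero_sub, neg_eq_zero]
    rw [← lie_skew, neg_add_cancel]
  have hD : D = 0 := by
    refine e.ext fun i => e.ext fun j => ?_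
    rcases lt_trichotomy i j with hij | rfl | hij
    · exact h i j hij
    · exact hself _
    · have h1 := hself (e i + e j)
      simp only [map_add, LinearMap.add_apply, hself, zero_add, add_zero] at h1
      have h2 : D (e j) (e i) = 0 := h j i hij
      rw [h2, zero_add] at h1
      exact h1
  intro x y
  exact sub_eq_zero.mp (LinearMap.congr_fun (LinearMap.congr_fun hD x) y)

end Reduction

/-! ### Coordinates on `𝓛₁₇,₇(a)` -/

namespace L177

/-- The coordinates of an element of `𝓛₁₇,₇(a)`. -/
noncomputable def coord (a : ℂ) : L177 a ≃ₗ[ℂ] (Fin 8 → ℂ) := LinearEquiv.refl ℂ (Fin 8 → ℂ)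

/-- The basis `l₀₁, l₀₂, l₁₀, l₂₀, l₁₁, l₂₂, l₁₂, l₂₁`. -/
noncomputable def basis (a : ℂ) : Module.Basis (Fin 8) ℂ (L177 a) := Module.Basis.ofEquivFun (coord a)

variable {a : ℂ}

theorem coord_basis (i : Fin 8) : coord a (basis a i) = Pi.single i 1 := by
  simp [basis]

theorem basis_apply (i : Fin 8) : basis a i = basisVec a i := by
  apply (coord a).injective
  rw [coord_basis]
  rfl

theorem coord_lie (x y : L177 a) : coord a ⁅x, y⁆ = bracket a (coord a x) (coord a y) := rfl

/-- The value at `[lᵢ, lⱼ]` of the linear functional with values `f` on the basis. -/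
def atLie (a : ℂ) (f : Fin 8 → ℂ) : Fin 8 → Fin 8 → ℂ :=
  ![![0, 0, -a * f 4, f 7, f 6, f 3, 0, 0],
    ![0, 0, f 6, 0, 0, f 7, 0, 0],
    ![a * f 4, -f 6, 0, 0, f 7, 0, 0, 0],
    ![-f 7, 0, 0, 0, 0, 0, 0, 0],
    ![-f 6, 0, -f 7, 0, 0, 0, 0, 0],
    ![-f 3, -f 7, 0, 0, 0, 0, 0, 0],
    0,
    0]

/-- The `m`-th coordinate of `[lᵢ, v]`. -/
def adCoord (a : ℂ) (v : Fin 8 → ℂ) : Fin 8 → Fin 8 → ℂ :=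
  ![![0, 0, 0, v 5, -a * v 2, 0, v 4, v 3],
    ![0, 0, 0, 0, 0, 0, v 2, v 5],
    ![0, 0, 0, 0, a * v 0, 0, -v 1, v 4],
    ![0, 0, 0, 0, 0, 0, 0, -v 0],
    ![0, 0, 0, 0, 0, 0, -v 0, -v 2],
    ![0, 0, 0, -v 0, 0, 0, 0, -v 1],
    0,
    0]

theorem bracket_single (v : Fin 8 → ℂ) (i m : Fin 8) :
    bracket a (Pi.single i 1) v m = adCoord a v i m := by
  fin_cases i <;> fin_cases m <;> simp [bracket, minor, adCoord]

theorem coord_basis_lie (v : L177 a) (i m : Fin 8) :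
    coord a ⁅basis a i, v⁆ m = adCoord a (coord a v) i m := by
  rw [coord_lie, coord_basis, bracket_single]

theorem map_lie_basis (f : L177 a →ₗ[ℂ] ℂ) (i j : Fin 8) :
    f ⁅basis a i, basis a j⁆ = atLie a (fun l => f (basis a l)) i j := by
  have h : ∀ x y : L177 a, ⁅x, y⁆ = ∑ m, bracket a (coord a x) (coord a y) m • basis a m := by
    intro x y
    rw [← coord_lie]
    exact ((basis a).sum_equivFun ⁅x, y⁆).symm
  have hf : ∀ x y : L177 a, f ⁅x, y⁆ =
      minor (coord a x) (coord a y) 0 5 * f (basis a 3) +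
      -a * minor (coord a x) (coord a y) 0 2 * f (basis a 4) +
      (minor (coord a x) (coord a y) 0 4 + minor (coord a x) (coord a y) 1 2) * f (basis a 6) +
      (minor (coord a x) (coord a y) 0 3 + minor (coord a x) (coord a y) 1 5 +
        minor (coord a x) (coord a y) 2 4) * f (basis a 7) := by
    intro x y
    rw [h, map_sum]
    simp [Fin.sum_univ_eight, bracket]
  rw [hf, coord_basis, coord_basis]
  fin_cases i <;> fin_cases j <;> simp [minor, atLie]

/-! ### Twisted cocycles in coordinates -/

/-- The coordinates of the vectors `B(lᵢ, lⱼ)`. -/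
noncomputable def cochainCoord (B : LieModule.Cohomology.twoCochain ℂ (L177 a) (L177 a))
    (i j m : Fin 8) : ℂ :=
  coord a (B (basis a i) (basis a j)) m

/-- The coordinates of the defect of the twisted cocycle identity on basis vectors, in terms of the
coordinates `b` of a bilinear map. -/
def coordDefect (a t : ℂ) (b : Fin 8 → Fin 8 → Fin 8 → ℂ) (i j k m : Fin 8) : ℂ :=
  atLie a (fun l => b i l m) j k + atLie a (fun l => b k l m) i j + atLie a (fun l => b j l m) k i
    + t * adCoord a (b j k) i m + t * adCoord a (b i j) k m + t * adCoord a (b k i) j m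

theorem cochainCoord_swap (B : LieModule.Cohomology.twoCochain ℂ (L177 a) (L177 a))
    (i j m : Fin 8) : cochainCoord B i j m = -cochainCoord B j i m := by
  simp only [cochainCoord]
  rw [← LieModule.Cohomology.twoCochain_skew B, map_neg, Pi.neg_apply]

theorem cochainCoord_self (B : LieModule.Cohomology.twoCochain ℂ (L177 a) (L177 a))
    (i m : Fin 8) : cochainCoord B i i m = 0 := by
  simp [cochainCoord]

theorem cochain_eq_zero (B : LieModule.Cohomology.twoCochain ℂ (L177 a) (L177 a))
    (h : ∀ i j, i < j → ∀ m, cochainCoord B i j m = 0) : B = 0 := by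
  apply Subtype.ext
  refine (basis a).ext fun i => (basis a).ext fun j => (coord a).injective ?_
  ext m
  change cochainCoord B i j m = coord a 0 m
  rw [map_zero, Pi.zero_apply]
  rcases lt_trichotomy i j with hij | rfl | hij
  · exact h i j hij m
  · exact cochainCoord_self B i m
  · rw [cochainCoord_swap, h j i hij m, neg_zero]

theorem coord_twistedDefect (t : ℂ) (B : LieModule.Cohomology.twoCochain ℂ (L177 a) (L177 a))
    (i j k m : Fin 8) :
    coord a (twistedDefect t B (basis a i) (basis a j) (basis a k)) m =
      coordDefect a t (cochainCoord B) i j k m := by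
  have hB : ∀ x i j, coord a (B x ⁅basis a i, basis a j⁆) m =
      atLie a (fun l => coord a (B x (basis a l)) m) i j := fun x i j =>
    map_lie_basis ((LinearMap.proj m).comp ((coord a).toLinearMap.comp (B x))) i j
  simp only [twistedDefect, map_add, map_smul, Pi.add_apply, Pi.smul_apply, smul_eq_mul, hB,
    coord_basis_lie]
  rfl

theorem mem_twistedCocycle_of_lt {t : ℂ}
    {B : LieModule.Cohomology.twoCochain ℂ (L177 a) (L177 a)}
    (h : ∀ i j k, i < j → j < k → ∀ m, coordDefect a t (cochainCoord B) i j k m = 0) :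
    B ∈ twistedCocycle (L177 a) 1 1 1 t t t := by
  rw [mem_twistedCocycle_iff_basis t B (basis a)]
  intro i j k hij hjk
  rw [← (coord a).map_eq_zero_iff]
  ext m
  rw [coord_twistedDefect, h i j k hij hjk m, Pi.zero_apply]

theorem coordDefect_eq_zero {t : ℂ} {B : LieModule.Cohomology.twoCochain ℂ (L177 a) (L177 a)}
    (h : B ∈ twistedCocycle (L177 a) 1 1 1 t t t) (i j k m : Fin 8) :
    coordDefect a t (cochainCoord B) i j k m = 0 := by
  rw [← coord_twistedDefect, (mem_twistedCocycle_iff_defect t B).mp h, map_zero, Pi.zero_apply]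

/-- The skew-symmetric extension of the entries `c i j m`, `i < j`. -/
def skewExt (c : Fin 8 → Fin 8 → Fin 8 → ℂ) (i j m : Fin 8) : ℂ :=
  if i < j then c i j m else if j < i then -c j i m else 0

theorem skewExt_cochainCoord (B : LieModule.Cohomology.twoCochain ℂ (L177 a) (L177 a)) :
    skewExt (cochainCoord B) = cochainCoord B := by
  funext i j m
  rcases lt_trichotomy i j with h | rfl | h
  · simp [skewExt, h]
  · simp [skewExt, cochainCoord_self]
  · rw [skewExt, if_neg h.not_gt, if_pos h, ← cochainCoord_swap]

/-- The alternating bilinear map with prescribed coordinates on the pairs `(lᵢ, lⱼ)`, `i < j`. -/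
noncomputable def cochainOf (a : ℂ) (c : Fin 8 → Fin 8 → Fin 8 → ℂ) :
    LieModule.Cohomology.twoCochain ℂ (L177 a) (L177 a) where
  val := LinearMap.mk₂ ℂ
    (fun x y => (coord a).symm fun m => ∑ i, ∑ j, coord a x i * coord a y j * skewExt c i j m)
    (by
      intro x x' y
      rw [← map_add]
      congr 1
      ext m
      simp [add_mul, Finset.sum_add_distrib])
    (by
      intro s x y
      rw [← map_smul]
      congr 1
      ext m
      simp [mul_assoc, Finset.mul_sum])
    (by
      intro x y y'
      rw [← map_add]
      congr 1
      ext m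
      simp [mul_add, add_mul, Finset.sum_add_distrib])
    (by
      intro s x y
      rw [← map_smul]
      congr 1
      ext m
      simp [mul_assoc, mul_left_comm, Finset.mul_sum])
  property := by
    intro x
    rw [LinearMap.mk₂_apply, LinearEquiv.map_eq_zero_iff]
    ext m
    have hskew : ∀ i j, skewExt c i j m = -skewExt c j i m := by
      intro i j
      rcases lt_trichotomy i j with h | rfl | h
      · simp [skewExt, h, h.not_gt]
      · simp [skewExt]
      · simp [skewExt, h, h.not_gt]
    have h : ∑ i, ∑ j, coord a x i * coord a x j * skewExt c i j m =
        -∑ i, ∑ j, coord a x i * coord a x j * skewExt c i j m := by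
      conv_lhs => rw [Finset.sum_comm]
      rw [← Finset.sum_neg_distrib]
      refine Finset.sum_congr rfl fun i _ => ?_
      rw [← Finset.sum_neg_distrib]
      refine Finset.sum_congr rfl fun j _ => ?_
      rw [hskew j i]
      ring
    exact self_eq_neg.mp h

theorem cochainCoord_cochainOf (c : Fin 8 → Fin 8 → Fin 8 → ℂ) :
    cochainCoord (cochainOf a c) = skewExt c := by
  funext i j m
  change coord a ((coord a).symm fun m => ∑ i', ∑ j', coord a (basis a i) i' *
    coord a (basis a j) j' * skewExt c i' j' m) m = _
  simp [coord_basis, Pi.single_apply]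

/-- The coordinate functional `B ↦ B(lᵢ, lⱼ)ₘ`, labelled by the triple `(i, j, m)`. -/
noncomputable def cochainFunctional (a : ℂ) (p : Fin 8 × Fin 8 × Fin 8) :
    LieModule.Cohomology.twoCochain ℂ (L177 a) (L177 a) →ₗ[ℂ] ℂ where
  toFun B := cochainCoord B p.1 p.2.1 p.2.2
  map_add' _ _ := rfl
  map_smul' _ _ := rfl

end L177

namespace L177

/-! ### The twisted cocycles in explicit form -/

/-- The general twisted cocycle of `𝓛₁₇,₇(a)` with parameter `t ≠ 0`, by its coordinates on the pairs
`(lᵢ, lⱼ)`, `i < j`. The parameters `u`, `v`, `w` are the coordinates with labels `(0, 4, 0)`,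
`(1, 4, 1)`, `(2, 4, 2)`; these and some of the `y i j m` are subject to the conditions of
`coordDefect_cocycleTable`, which become weaker at exceptional values of `t`. The `y i j m` are
scaled so that the entries are polynomials in `a` and `t`. -/
def cocycleTable (a t u v w : ℂ) (y : Fin 8 → Fin 8 → Fin 8 → ℂ) : Fin 8 → Fin 8 → Fin 8 → ℂ :=
  ![![0, y 0 1, y 0 2,
      ![y 1 5 0 + 2 * y 3 5 5, y 0 3 1,
      (1 + t) * u + a * v + y 4 7 7 - t * y 4 5 5 - 2 * a * t * y 5 6 3, y 0 3 3,
      a * y 0 5 2 + y 1 2 1 + y 1 5 4 + (t - 1) * y 2 5 5 + 2 * a * y 4 5 3 + (a - 1) * y 5 6 7 -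
        (1 + t) * y 0 2 0 - a * y 0 4 1,
      (t - 1) * y 1 2 2 + t * y 1 5 5 + (1 - t) * y 2 4 5 + (a - 1) * y 2 6 3 - (1 +
        2 * t) * y 0 1 0 - 2 * y 1 4 4, y 0 3 6, y 0 3 7],
      ![u, y 0 4 1, y 0 4 2, y 0 4 3, y 0 4 4, y 0 4 5, y 0 4 6, y 0 4 7], y 0 5,
      ![0, -a * v, -a * t * y 1 4 2, -t * y 1 2 5 - a * y 1 4 3,
      a * t * y 1 2 2 - a * t * y 0 1 0 - a * y 1 4 4, -a * y 1 4 5,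
      t * y 0 1 1 + t * y 0 2 2 - t * y 1 2 4 - a * y 1 4 6,
      t * y 0 2 5 - t * y 0 1 4 - t * y 1 2 3 - a * y 1 4 7],
      ![0, y 3 5 5, 0, a * y 2 6 3 - t * y 2 4 5,
      2 * a * t * y 4 5 5 + a * y 4 7 7 + a ^ 2 * t * y 5 6 3 - a * t * u, -a * t * y 1 4 2,
      y 0 7 6, y 0 7 7]],
    ![0, 0,
      ![a * u + (a - a ^ 2) * y 5 6 3 - 2 * a * y 4 5 5, y 1 2 1, y 1 2 2, y 1 2 3, y 1 2 4,
      y 1 2 5, y 1 2 6, y 1 2 7],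
      ![0, y 3 5 5, 0, t * y 1 5 5 + a * y 2 6 3 - t * y 0 1 0 - t * y 2 4 5,
      3 * a * t * y 4 5 5 + (a - a * t) * y 4 7 7 + a ^ 2 * t * y 5 6 3 - a * t * u - a * t * v,
      -a * t * y 1 4 2, y 0 7 6 + t * y 1 5 4 - t * y 0 5 2,
      y 0 7 7 + t * y 1 5 3 - t * y 0 1 1 - t * y 0 5 5],
      ![0, v, y 1 4 2, y 1 4 3, y 1 4 4, y 1 4 5, y 1 4 6, y 1 4 7],
      ![y 1 5 0,
      y 0 3 1 + (a - a * t) * y 0 5 0 + 2 * a * y 4 5 4 + (a - 1) * y 5 6 6 - (1 +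
        a * t) * y 2 5 2, v + y 4 7 7 - y 4 5 5, y 1 5 3, y 1 5 4, y 1 5 5, y 1 5 6, y 1 5 7],
      ![0, 0, 0, t * y 1 4 5, -a * t * y 1 4 2, 0, t * y 1 4 4 - t * y 0 1 0 - t * y 0 4 2,
      t * y 1 4 3 - t * y 0 1 2 - t * y 0 4 5],
      ![0, 0, 0, -a * t * y 1 4 2, 0, 0,
      (t ^ 2 + 3 * a * t ^ 2) * y 4 5 5 + (a * t - t - a * t ^ 2) * y 4 7 7 + (2 * a * t ^ 2 +
        a ^ 2 * t ^ 2) * y 5 6 3 - (t + t ^ 2 + a * t ^ 2) * u - (a * t + a * t ^ 2) * v,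
      t ^ 2 * y 0 1 0 + (t - t ^ 2) * y 1 2 2 + 2 * t * y 1 4 4 + t * y 2 6 3 - t * y 2 4 5]],
    ![0, 0, 0,
      ![0, 2 * a * y 4 5 1, 0, t * y 2 5 5 + a * y 4 5 3 - t * y 0 2 0,
      a * y 4 5 4 - a * t * y 0 5 0 - a * t * y 2 5 2, a * y 4 5 5,
      t * y 0 5 1 + t * y 2 5 4 + a * y 4 5 6,
      t * y 2 5 3 + a * y 4 5 7 - t * y 0 2 1 - t * y 0 5 4],
      ![y 1 5 0, y 2 4 1, w, y 2 4 3, y 2 4 4, y 2 4 5, y 2 4 6, y 2 4 7],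
      ![(1 + a) * y 4 5 1, y 2 5 1, y 2 5 2, y 2 5 3, y 2 5 4, y 2 5 5, y 2 5 6, y 2 5 7],
      ![0, y 3 5 5, 0, a * y 2 6 3,
      2 * a * t * y 4 5 5 + a * y 4 7 7 + a ^ 2 * t * y 5 6 3 - 2 * a * t * u - a * t * w,
      -a * t * y 1 4 2, t * y 0 4 1 + y 0 7 6 + t * y 2 4 4 - t * y 0 2 0,
      y 0 7 7 + t * y 2 4 3 - t * y 0 2 2 - t * y 0 4 4],
      ![0, 0, 0, 2 * a * t * y 4 5 5 + a ^ 2 * t * y 5 6 3 - a * t * u, -a * t * y 1 5 0 - y 3 5 5,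
      0,
      t * y 0 3 1 + (a * t - a * t ^ 2) * y 0 5 0 + 2 * a * t * y 4 5 4 + a * t * y 5 6 6 -
        a * t ^ 2 * y 2 5 2, t * y 2 5 5 + t * y 5 6 7 - t * y 1 2 1 - t * y 1 5 4]],
    ![0, 0, 0, 0,
      ![0, 0, 0, t * u - t * y 4 5 5 - a * t * y 5 6 3, y 3 5 5, 0,
      -t * y 0 5 0 - t * y 4 5 4 - t * y 5 6 6,
      t * y 0 4 1 - t * y 0 5 2 - t * y 4 5 3 - t * y 5 6 7],
      ![0, 0, 0, y 0 3 1 + y 2 5 2 + y 4 5 4 - y 0 5 0 - y 2 4 1, (a - 1) * y 4 5 1, 2 * y 3 5 5,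
      y 3 5 6, y 3 5 7], ![0, 0, 0, 0, 0, 0, -t * y 3 5 5, a * t ^ 2 * y 5 6 3 - a * t * v],
      ![0, 0, 0, 0, 0, 0, 0, t * y 1 5 0 + t * y 3 5 5]],
    ![0, 0, 0, 0, 0, ![0, 2 * y 4 5 1, 0, y 4 5 3, y 4 5 4, y 4 5 5, y 4 5 6, y 4 5 7],
      ![0, 0, 0, a * t * y 1 4 2, 0, 0,
      2 * t ^ 2 * u + t * v + t ^ 2 * w - 2 * t ^ 2 * y 4 5 5 - t * y 4 7 7 - a * t ^ 2 * y 5 6 3,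
      t ^ 2 * y 1 2 2 - t ^ 2 * y 0 1 0 - t * y 1 4 4 - t * y 2 6 3],
      ![0, 0, 0, 0, 0, 0, t * y 1 5 0, t * y 4 7 7]],
    ![0, 0, 0, 0, 0, 0, ![0, 0, 0, a * t * y 5 6 3, -y 3 5 5, 0, t * y 5 6 6, t * y 5 6 7],
      ![0, 0, 0, t * y 1 5 0, 0, 0, (t - a * t) * y 4 5 1,
      t * y 2 4 1 - t * y 2 5 2 - t * y 4 5 4]],
    0,
    0]

variable {a t : ℂ}

set_option maxHeartbeats 4000000 in
theorem coordDefect_cocycleTable {u v w : ℂ} {y : Fin 8 → Fin 8 → Fin 8 → ℂ}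
    (h145 : (t + a) * y 1 4 5 = 0) (h142 : (t - 1) * y 1 4 2 = 0) (h142' : (a - 1) * y 1 4 2 = 0)
    (h150 : (t - 1) * y 1 5 0 = 0) (h355 : (2 * a * t - (1 - a)) * y 3 5 5 = 0)
    (hq : (t - 1) * (u + v - 3 * y 4 5 5 + y 4 7 7 + (1 - a) * y 5 6 3) = 0)
    (hr : 2 * a * (u + v - 3 * y 4 5 5 + y 4 7 7 + (1 - a) * y 5 6 3) + (1 - t) * u - 2 * v
      + (t + a) * y 4 5 5 + (2 - 2 * a) * y 4 7 7 - 2 * a * t * y 5 6 3 - (1 + t) * w = 0)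
    (i j k : Fin 8) (hij : i < j) (hjk : j < k) (m : Fin 8) :
    coordDefect a t (skewExt (cocycleTable a t u v w y)) i j k m = 0 := by
  fin_cases i <;> fin_cases j <;> first
    | exact absurd hij (by decide)
    | (fin_cases k <;> first
         | exact absurd hjk (by decide)
         | (fin_cases m <;>
              (simp only [coordDefect, atLie, adCoord, Fin.mk_zero', Fin.mk_one,
                  Fin.reduceFinMk, ↓Matrix.cons_val, Pi.zero_apply]
               try simp only [skewExt, Fin.reduceLT, if_true, if_false]
               try simp only [cocycleTable, ↓Matrix.cons_val, Pi.zero_apply]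
               first
                 | ring1
                 | grind)))

/-- The general twisted cocycle of `𝓛₁₇,₇(a)` with parameter `0`, by the vectors `B(lᵢ, lⱼ)`, `i < j`.
The brackets with values of `B` drop out of the defining identity, so that it holds for each
coordinate of `B` separately. -/
def cocycleTableZero (a : ℂ) (y : Fin 8 → Fin 8 → Fin 8 → ℂ) : Fin 8 → Fin 8 → Fin 8 → ℂ :=
  ![![0, y 0 1, y 0 2, y 0 3, y 0 4, y 0 5, -a • y 1 4, y 1 3],
    ![0, 0, y 1 2, y 1 3, y 1 4, y 1 5, 0, 0],
    ![0, 0, 0, a • y 4 5, y 2 4, y 2 5, y 1 3, -a • y 3 4],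
    ![0, 0, 0, 0, y 3 4, y 3 5, 0, 0],
    ![0, 0, 0, 0, 0, y 4 5, 0, 0],
    ![0, 0, 0, 0, 0, 0, -y 3 4, 0],
    0,
    0]

set_option maxHeartbeats 4000000 in
theorem coordDefect_cocycleTableZero {y : Fin 8 → Fin 8 → Fin 8 → ℂ}
    (h34 : ∀ m, (a - 1) * y 3 4 m = 0) (i j k : Fin 8) (hij : i < j) (hjk : j < k) (m : Fin 8) :
    coordDefect a 0 (skewExt (cocycleTableZero a y)) i j k m = 0 := by
  fin_cases i <;> fin_cases j <;> first
    | exact absurd hij (by decide)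
    | (fin_cases k <;> first
         | exact absurd hjk (by decide)
         | (fin_cases m <;>
              (simp only [coordDefect, atLie, adCoord, Fin.mk_zero', Fin.mk_one,
                  Fin.reduceFinMk, ↓Matrix.cons_val, Pi.zero_apply]
               try simp only [skewExt, Fin.reduceLT, if_true, if_false]
               try simp only [cocycleTableZero, ↓Matrix.cons_val, Pi.zero_apply, Pi.smul_apply,
                  Pi.neg_apply, smul_eq_mul]
               first
                 | ring1
                 | linear_combination h34 _)))

end L177

namespace L177
variable {a t : ℂ}

/-! ### The coordinates that determine a twisted cocycle -/

/-- The labels of the 79 coordinates that take arbitrary values on the twisted cocycles for every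
parameter `t ≠ 0`. -/
def isFree (i j m : Fin 8) : Prop :=
  m ∈ (![
    ![∅, Finset.univ, Finset.univ, {1, 3, 6, 7}, {1, 2, 3, 4, 5, 6, 7}, Finset.univ, ∅, {6, 7}],
    ![∅, ∅, {1, 2, 3, 4, 5, 6, 7}, ∅, {3, 4, 6, 7}, {3, 4, 5, 6, 7}, ∅, ∅],
    ![∅, ∅, ∅, ∅, {1, 3, 4, 5, 6, 7}, {1, 2, 3, 4, 5, 6, 7}, {3}, ∅],
    ![∅, ∅, ∅, ∅, ∅, {6, 7}, ∅, ∅],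
    ![∅, ∅, ∅, ∅, ∅, {1, 3, 4, 5, 6, 7}, ∅, {7}],
    ![∅, ∅, ∅, ∅, ∅, ∅, {3, 6, 7}, ∅],
    fun _ => ∅,
    fun _ => ∅] : Fin 8 → Fin 8 → Finset (Fin 8)) i j

instance (i j m : Fin 8) : Decidable (isFree i j m) := by unfold isFree; infer_instance

set_option maxHeartbeats 4000000 in
/-- A twisted cocycle with parameter `t ≠ 0` is determined by its free coordinates, by the sum of the
coordinates with labels `(0, 4, 0)` and `(2, 4, 2)`, and, for exceptional `t`, by some further
coordinates. -/
theorem eq_zero_of_free_eq_zero {c : Fin 8 → Fin 8 → Fin 8 → ℂ} (ha : a ≠ 0) (ht : t ≠ 0)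
    (E : ∀ i j k m, coordDefect a t (skewExt c) i j k m = 0)
    (h : ∀ i j m, isFree i j m → c i j m = 0)
    (hd : c 0 4 0 + c 2 4 2 = 0) (h145 : t + a = 0 → c 1 4 5 = 0)
    (h142 : t = 1 → a = 1 → c 1 4 2 = 0) (h150 : t = 1 → c 1 5 0 = 0)
    (h355 : 2 * a * t = 1 - a → c 3 5 5 = 0) (hq : t = 1 → c 1 2 0 + a * c 1 5 2 = 0)
    (i j : Fin 8) (hij : i < j) (m : Fin 8) : c i j m = 0 := by
  -- Put `l₀₁, l₀₂, l₁₀, l₂₀, l₁₁, l₂₂, l₁₂, l₂₁` in the degrees `(1, 0)`, `(2, 0)`, `(0, 1)`,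
  -- `(0, 2)`, `(1, 1)`, `(-1, 2)`, `(2, 1)`, `(1, 2)` of `ℤ × ℤ`. This is a Lie algebra grading, so
  -- that the cocycle identities couple only coordinates of the same degree. The degrees are
  -- treated one at a time, in increasing lexicographic order.
  have z165 :
      c 1 6 5 = 0 := by
    have e0 := E 0 1 4 5
    simp (decide := true) only [coordDefect, atLie, adCoord, skewExt, h, if_true, if_false,
      ↓Matrix.cons_val, mul_zero, add_zero, zero_add, neg_zero]
      at e0
    grind
  have z675 :
      c 6 7 5 = 0 := by
    have e0 := E 0 3 6 5
    simp (decide := true) only [coordDefect, atLie, adCoord, skewExt, if_true, if_false,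
      ↓Matrix.cons_val, Pi.zero_apply, mul_zero, add_zero, zero_add]
      at e0
    grind
  obtain ⟨z162, z175, z465⟩ :
      c 1 6 2 = 0 ∧ c 1 7 5 = 0 ∧ c 4 6 5 = 0 := by
    have e0 := E 0 1 3 5; have e1 := E 0 1 4 2; have e2 := E 1 2 4 5
    simp (decide := true) only [coordDefect, atLie, adCoord, skewExt, h, if_true, if_false,
      ↓Matrix.cons_val, mul_zero, add_zero, zero_add, neg_zero]
      at e0 e1 e2
    grind
  obtain ⟨z065, z145, z163⟩ :
      c 0 6 5 = 0 ∧ c 1 4 5 = 0 ∧ c 1 6 3 = 0 := by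
    have e0 := E 0 1 2 5; have e1 := E 0 1 4 3; have e2 := E 0 1 6 7
    simp (decide := true) only [coordDefect, atLie, adCoord, skewExt, h, if_true, if_false,
      ↓Matrix.cons_val, Pi.zero_apply, mul_zero, add_zero, zero_add, neg_zero]
      at e0 e1 e2
    grind
  have z672 :
      c 6 7 2 = 0 := by
    have e0 := E 0 3 6 2
    simp (decide := true) only [coordDefect, atLie, adCoord, skewExt, if_true, if_false,
      ↓Matrix.cons_val, Pi.zero_apply, mul_zero, add_zero, zero_add]
      at e0
    grind
  obtain ⟨z160, z172, z365, z462, z475, z673⟩ :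
      c 1 6 0 = 0 ∧ c 1 7 2 = 0 ∧ c 3 6 5 = 0 ∧ c 4 6 2 = 0 ∧ c 4 7 5 = 0 ∧ c 6 7 3 = 0 := by
    have e0 := E 0 1 3 2; have e1 := E 0 1 4 0; have e2 := E 0 3 4 5; have e3 := E 0 3 6 3
    have e4 := E 0 5 6 5; have e5 := E 1 2 4 2
    simp (decide := true) only [coordDefect, atLie, adCoord, skewExt, h, if_true, if_false,
      ↓Matrix.cons_val, Pi.zero_apply, mul_zero, add_zero, zero_add, neg_zero]
      at e0 e1 e2 e3 e4 e5
    grind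
  obtain ⟨z062, z075, z135, z142, z164, z173, z265, z463⟩ :
      c 0 6 2 = 0 ∧ c 0 7 5 = 0 ∧ c 1 3 5 = 0 ∧ c 1 4 2 = 0 ∧ c 1 6 4 = 0 ∧ c 1 7 3 = 0 ∧
      c 2 6 5 = 0 ∧ c 4 6 3 = 0 := by
    have e0 := E 0 1 2 2; have e1 := E 0 1 3 3; have e2 := E 0 1 4 4; have e3 := E 0 1 5 5
    have e4 := E 0 1 6 6; have e5 := E 0 1 7 7; have e6 := E 0 2 4 5; have e7 := E 0 2 6 3
    have e8 := E 0 4 6 7; have e9 := E 1 2 4 3; have e10 := E 1 2 6 7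
    simp (decide := true) only [coordDefect, atLie, adCoord, skewExt, h, if_true, if_false,
      ↓Matrix.cons_val, Pi.zero_apply, mul_zero, add_zero, zero_add, neg_zero]
      at e0 e1 e2 e3 e4 e5 e6 e7 e8 e9 e10
    grind
  obtain ⟨z063, z167⟩ :
      c 0 6 3 = 0 ∧ c 1 6 7 = 0 := by
    have e0 := E 0 1 2 3; have e1 := E 0 1 4 7
    simp (decide := true) only [coordDefect, atLie, adCoord, skewExt, h, if_true, if_false,
      ↓Matrix.cons_val, mul_zero, add_zero, zero_add, neg_zero]
      at e0 e1
    grind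
  have z670 :
      c 6 7 0 = 0 := by
    have e0 := E 0 3 6 0
    simp (decide := true) only [coordDefect, atLie, adCoord, skewExt, if_true, if_false,
      ↓Matrix.cons_val, Pi.zero_apply, mul_zero, add_zero, zero_add]
      at e0
    grind
  obtain ⟨z170, z362, z375, z460, z472, z674⟩ :
      c 1 7 0 = 0 ∧ c 3 6 2 = 0 ∧ c 3 7 5 = 0 ∧ c 4 6 0 = 0 ∧ c 4 7 2 = 0 ∧ c 6 7 4 = 0 := by
    have e0 := E 0 1 3 0; have e1 := E 0 3 4 2; have e2 := E 0 3 6 4; have e3 := E 0 5 6 2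
    have e4 := E 0 5 7 5; have e5 := E 1 2 4 0
    simp (decide := true) only [coordDefect, atLie, adCoord, skewExt, h, if_true, if_false,
      ↓Matrix.cons_val, Pi.zero_apply, mul_zero, add_zero, zero_add, neg_zero]
      at e0 e1 e2 e3 e4 e5
    grind
  obtain ⟨z060, z072, z132, z140, z161, z174, z262, z275, z345, z363, z464, z473, z565, z677⟩ :
      c 0 6 0 = 0 ∧ c 0 7 2 = 0 ∧ c 1 3 2 = 0 ∧ c 1 4 0 = 0 ∧ c 1 6 1 = 0 ∧ c 1 7 4 = 0 ∧
      c 2 6 2 = 0 ∧ c 2 7 5 = 0 ∧ c 3 4 5 = 0 ∧ c 3 6 3 = 0 ∧ c 4 6 4 = 0 ∧ c 4 7 3 = 0 ∧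
      c 5 6 5 = 0 ∧ c 6 7 7 = 0 := by
    have e0 := E 0 1 2 0; have e1 := E 0 1 3 4; have e2 := E 0 1 4 1; have e3 := E 0 1 5 2
    have e4 := E 0 2 3 5; have e5 := E 0 2 4 2; have e6 := E 0 2 7 3; have e7 := E 0 3 4 3
    have e8 := E 0 4 5 5; have e9 := E 0 4 7 7; have e10 := E 1 2 3 3; have e11 := E 1 2 4 4
    have e12 := E 1 2 6 6; have e13 := E 1 3 4 7
    simp (decide := true) only [coordDefect, atLie, adCoord, skewExt, h, if_true, if_false,
      ↓Matrix.cons_val, Pi.zero_apply, mul_zero, add_zero, zero_add, neg_zero]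
      at e0 e1 e2 e3 e4 e5 e6 e7 e8 e9 e10 e11 e12 e13
    grind
  obtain ⟨z035, z064, z073, z133, z166, z177, z467⟩ :
      c 0 3 5 = 0 ∧ c 0 6 4 = 0 ∧ c 0 7 3 = 0 ∧ c 1 3 3 = 0 ∧ c 1 6 6 = 0 ∧ c 1 7 7 = 0 ∧
      c 4 6 7 = 0 := by
    have e0 := E 0 1 2 4; have e1 := E 0 1 3 7; have e2 := E 0 1 4 6; have e3 := E 0 1 5 3
    have e4 := E 0 2 4 3; have e5 := E 0 2 6 7; have e6 := E 1 2 4 7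
    simp (decide := true) only [coordDefect, atLie, adCoord, skewExt, h, if_true, if_false,
      ↓Matrix.cons_val, Pi.zero_apply, mul_zero, add_zero, zero_add, neg_zero]
      at e0 e1 e2 e3 e4 e5 e6
    grind
  have z067 :
      c 0 6 7 = 0 := by
    have e0 := E 0 1 2 7
    simp (decide := true) only [coordDefect, atLie, adCoord, skewExt, h, if_true, if_false,
      ↓Matrix.cons_val, mul_zero, add_zero, neg_zero]
      at e0
    grind
  obtain ⟨z360, z372, z470, z671⟩ :
      c 3 6 0 = 0 ∧ c 3 7 2 = 0 ∧ c 4 7 0 = 0 ∧ c 6 7 1 = 0 := by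
    have e0 := E 0 3 4 0; have e1 := E 0 3 6 1; have e2 := E 0 5 6 0; have e3 := E 0 5 7 2
    simp (decide := true) only [coordDefect, atLie, adCoord, skewExt, h, if_true, if_false,
      ↓Matrix.cons_val, Pi.zero_apply, mul_zero, add_zero, zero_add]
      at e0 e1 e2 e3
    grind
  obtain ⟨z070, z130, z171, z260, z272, z342, z364, z373, z461, z474, z562, z575, z676⟩ :
      c 0 7 0 = 0 ∧ c 1 3 0 = 0 ∧ c 1 7 1 = 0 ∧ c 2 6 0 = 0 ∧ c 2 7 2 = 0 ∧ c 3 4 2 = 0 ∧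
      c 3 6 4 = 0 ∧ c 3 7 3 = 0 ∧ c 4 6 1 = 0 ∧ c 4 7 4 = 0 ∧ c 5 6 2 = 0 ∧ c 5 7 5 = 0 ∧
      c 6 7 6 = 0 := by
    have e0 := E 0 1 3 1; have e1 := E 0 1 5 0; have e2 := E 0 2 4 0; have e3 := E 0 3 5 5
    have e4 := E 0 3 7 7; have e5 := E 0 4 5 2; have e6 := E 0 4 7 6; have e7 := E 1 2 3 4
    have e8 := E 1 2 4 1; have e9 := E 1 2 5 2; have e10 := E 1 2 7 6; have e11 := E 1 4 5 4
    have e12 := E 2 3 4 3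
    simp (decide := true) only [coordDefect, atLie, adCoord, skewExt, h, if_true, if_false,
      ↓Matrix.cons_val, Pi.zero_apply, mul_zero, add_zero, zero_add, neg_zero]
      at e0 e1 e2 e3 e4 e5 e6 e7 e8 e9 e10 e11 e12
    grind
  obtain ⟨z032, z040, z061, z074, z120, z134, z141, z152, z176, z235, z242, z264, z273, z343, z367,
    z466⟩ :
      c 0 3 2 = 0 ∧ c 0 4 0 = 0 ∧ c 0 6 1 = 0 ∧ c 0 7 4 = 0 ∧ c 1 2 0 = 0 ∧ c 1 3 4 = 0 ∧
      c 1 4 1 = 0 ∧ c 1 5 2 = 0 ∧ c 1 7 6 = 0 ∧ c 2 3 5 = 0 ∧ c 2 4 2 = 0 ∧ c 2 6 4 = 0 ∧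
      c 2 7 3 = 0 ∧ c 3 4 3 = 0 ∧ c 3 6 7 = 0 ∧ c 4 6 6 = 0 := by
    have e0 := E 0 1 2 1; have e1 := E 0 1 3 6; have e2 := E 0 1 5 4; have e3 := E 0 2 3 3
    have e4 := E 0 2 4 4; have e5 := E 0 2 5 5; have e6 := E 0 2 6 6; have e7 := E 0 2 7 7
    have e8 := E 0 3 4 7; have e9 := E 0 4 5 3; have e10 := E 0 5 6 7; have e11 := E 1 2 3 7
    have e12 := E 1 2 4 6; have e13 := E 1 2 5 3; have e14 := E 1 4 5 7
    simp (decide := true) only [coordDefect, atLie, adCoord, skewExt, h, if_true, if_false,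
      ↓Matrix.cons_val, Pi.zero_apply, mul_zero, add_zero, zero_add, neg_zero]
      at e0 e1 e2 e3 e4 e5 e6 e7 e8 e9 e10 e11 e12 e13 e14
    -- In degree `(-1, -1)` one combination vanishes only up to a factor `t - 1`.
    have k1 : (t - 1) * (c 1 2 0 + a * c 1 5 2) = 0 := by grind
    have k2 : c 1 2 0 + a * c 1 5 2 = 0 := by
      rcases mul_eq_zero.mp k1 with k | k
      · exact hq (sub_eq_zero.mp k)
      · exact k
    clear h355 h150 h145 h142 hq
    have k3 : c 2 4 2 = 0 := by grind
    grind
  obtain ⟨z066, z137, z267⟩ :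
      c 0 6 6 = 0 ∧ c 1 3 7 = 0 ∧ c 2 6 7 = 0 := by
    have e0 := E 0 1 2 6; have e1 := E 0 1 5 7; have e2 := E 0 2 4 7
    simp (decide := true) only [coordDefect, atLie, adCoord, skewExt, h, if_true, if_false,
      ↓Matrix.cons_val, mul_zero, add_zero, zero_add, neg_zero]
      at e0 e1 e2
    grind
  have z370 :
      c 3 7 0 = 0 := by
    have e0 := E 0 5 7 0
    simp (decide := true) only [coordDefect, atLie, adCoord, skewExt, if_true, if_false,
      ↓Matrix.cons_val, Pi.zero_apply, mul_zero, add_zero, zero_add]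
      at e0
    grind
  obtain ⟨z270, z340, z361, z374, z471, z560, z572⟩ :
      c 2 7 0 = 0 ∧ c 3 4 0 = 0 ∧ c 3 6 1 = 0 ∧ c 3 7 4 = 0 ∧ c 4 7 1 = 0 ∧ c 5 6 0 = 0 ∧
      c 5 7 2 = 0 := by
    have e0 := E 0 3 4 1; have e1 := E 0 3 5 2; have e2 := E 0 4 5 0; have e3 := E 0 5 6 1
    have e4 := E 0 5 7 4; have e5 := E 1 2 5 0; have e6 := E 2 3 7 7
    simp (decide := true) only [coordDefect, atLie, adCoord, skewExt, h, if_true, if_false,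
      ↓Matrix.cons_val, Pi.zero_apply, mul_zero, add_zero, zero_add, neg_zero]
      at e0 e1 e2 e3 e4 e5 e6
    grind
  obtain ⟨z030, z071, z131, z150, z232, z240, z261, z274, z344, z355, z366, z377, z452, z476, z564,
    z573⟩ :
      c 0 3 0 = 0 ∧ c 0 7 1 = 0 ∧ c 1 3 1 = 0 ∧ c 1 5 0 = 0 ∧ c 2 3 2 = 0 ∧ c 2 4 0 = 0 ∧
      c 2 6 1 = 0 ∧ c 2 7 4 = 0 ∧ c 3 4 4 = 0 ∧ c 3 5 5 = 0 ∧ c 3 6 6 = 0 ∧ c 3 7 7 = 0 ∧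
      c 4 5 2 = 0 ∧ c 4 7 6 = 0 ∧ c 5 6 4 = 0 ∧ c 5 7 3 = 0 := by
    have e0 := E 0 1 5 1; have e1 := E 0 2 3 4; have e2 := E 0 2 4 1; have e3 := E 0 2 5 2
    have e4 := E 0 2 7 6; have e5 := E 0 3 4 6; have e6 := E 0 3 5 3; have e7 := E 0 4 5 4
    have e8 := E 0 5 6 6; have e9 := E 0 5 7 7; have e10 := E 1 2 3 6; have e11 := E 1 2 5 4
    have e12 := E 1 3 5 7; have e13 := E 1 4 5 6; have e14 := E 2 3 4 7; have e15 := E 2 4 5 3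
    have e16 := E 2 5 6 7
    simp (decide := true) only [coordDefect, atLie, adCoord, skewExt, h, if_true, if_false,
      ↓Matrix.cons_val, Pi.zero_apply, mul_zero, add_zero, zero_add, neg_zero]
      at e0 e1 e2 e3 e4 e5 e6 e7 e8 e9 e10 e11 e12 e13 e14 e15 e16
    -- In degree `(0, -2)` two coordinates vanish only up to factors that depend on `t`.
    have k1 : (t - 1) * c 1 5 0 = 0 := by grind
    have k2 : c 1 5 0 = 0 := by
      rcases mul_eq_zero.mp k1 with k | k
      · exact h150 (sub_eq_zero.mp k)
      · exact k
    have k3 : (2 * a * t - (1 - a)) * c 3 5 5 = 0 := by grind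
    have k4 : c 3 5 5 = 0 := by
      rcases mul_eq_zero.mp k3 with k | k
      · exact h355 (sub_eq_zero.mp k)
      · exact k
    clear h355 h150 h145 h142 hq
    grind
  obtain ⟨z034, z136, z233, z266, z277, z347⟩ :
      c 0 3 4 = 0 ∧ c 1 3 6 = 0 ∧ c 2 3 3 = 0 ∧ c 2 6 6 = 0 ∧ c 2 7 7 = 0 ∧ c 3 4 7 = 0 := by
    have e0 := E 0 1 5 6; have e1 := E 0 2 3 7; have e2 := E 0 2 4 6; have e3 := E 0 2 5 3
    have e4 := E 0 4 5 7; have e5 := E 1 2 5 7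
    simp (decide := true) only [coordDefect, atLie, adCoord, skewExt, h, if_true, if_false,
      ↓Matrix.cons_val, mul_zero, add_zero, zero_add, neg_zero]
      at e0 e1 e2 e3 e4 e5
    grind
  obtain ⟨z371, z570⟩ :
      c 3 7 1 = 0 ∧ c 5 7 0 = 0 := by
    have e0 := E 0 3 5 0; have e1 := E 0 5 7 1
    simp (decide := true) only [coordDefect, atLie, adCoord, skewExt, h, if_true, if_false,
      ↓Matrix.cons_val, Pi.zero_apply, mul_zero, add_zero, zero_add, neg_zero]
      at e0 e1
    grind
  obtain ⟨z230, z271, z341, z352, z376, z450, z561, z574⟩ :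
      c 2 3 0 = 0 ∧ c 2 7 1 = 0 ∧ c 3 4 1 = 0 ∧ c 3 5 2 = 0 ∧ c 3 7 6 = 0 ∧ c 4 5 0 = 0 ∧
      c 5 6 1 = 0 ∧ c 5 7 4 = 0 := by
    have e0 := E 0 2 3 1; have e1 := E 0 2 5 0; have e2 := E 0 4 5 1; have e3 := E 0 5 7 6
    have e4 := E 1 3 5 6; have e5 := E 2 3 4 6; have e6 := E 2 3 5 3; have e7 := E 2 4 5 4
    simp (decide := true) only [coordDefect, atLie, adCoord, skewExt, h, if_true, if_false,
      ↓Matrix.cons_val, Pi.zero_apply, mul_zero, add_zero, zero_add, neg_zero]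
      at e0 e1 e2 e3 e4 e5 e6 e7
    grind
  obtain ⟨z151, z234, z276, z346, z353, z577⟩ :
      c 1 5 1 = 0 ∧ c 2 3 4 = 0 ∧ c 2 7 6 = 0 ∧ c 3 4 6 = 0 ∧ c 3 5 3 = 0 ∧ c 5 7 7 = 0 := by
    have e0 := E 0 2 3 6; have e1 := E 0 2 5 4; have e2 := E 0 3 5 7; have e3 := E 0 4 5 6
    have e4 := E 1 2 5 6; have e5 := E 2 4 5 7
    simp (decide := true) only [coordDefect, atLie, adCoord, skewExt, h, if_true, if_false,
      ↓Matrix.cons_val, mul_zero, add_zero, zero_add, neg_zero]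
      at e0 e1 e2 e3 e4 e5
    grind
  have z237 :
      c 2 3 7 = 0 := by
    have e0 := E 0 2 5 7
    simp (decide := true) only [coordDefect, atLie, adCoord, skewExt, h, if_true, if_false,
      ↓Matrix.cons_val, mul_zero, add_zero, zero_add, neg_zero]
      at e0
    grind
  obtain ⟨z350, z571⟩ :
      c 3 5 0 = 0 ∧ c 5 7 1 = 0 := by
    have e0 := E 0 3 5 1; have e1 := E 3 4 5 6
    simp (decide := true) only [coordDefect, atLie, adCoord, skewExt, h, if_true, if_false,
      ↓Matrix.cons_val, mul_zero, add_zero, zero_add, neg_zero]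
      at e0 e1
    grind
  obtain ⟨z231, z250, z354, z576⟩ :
      c 2 3 1 = 0 ∧ c 2 5 0 = 0 ∧ c 3 5 4 = 0 ∧ c 5 7 6 = 0 := by
    have e0 := E 0 2 5 1; have e1 := E 0 3 5 6; have e2 := E 2 3 5 7; have e3 := E 2 4 5 6
    simp (decide := true) only [coordDefect, atLie, adCoord, skewExt, h, if_true, if_false,
      ↓Matrix.cons_val, mul_zero, add_zero, zero_add, neg_zero]
      at e0 e1 e2 e3
    grind
  have z236 :
      c 2 3 6 = 0 := by
    have e0 := E 0 2 5 6
    simp (decide := true) only [coordDefect, atLie, adCoord, skewExt, h, if_true, if_false,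
      ↓Matrix.cons_val, mul_zero, add_zero, zero_add, neg_zero]
      at e0
    grind
  have z351 :
      c 3 5 1 = 0 := by
    have e0 := E 2 3 5 6
    simp (decide := true) only [coordDefect, atLie, adCoord, skewExt, h, if_true, if_false,
      ↓Matrix.cons_val, mul_zero, add_zero, zero_add, neg_zero]
      at e0
    grind
  fin_cases i <;> fin_cases j <;> first
    | exact absurd hij (by decide)
    | (fin_cases m <;> first
        | exact h _ _ _ (by decide)
        | (simp only [Fin.mk_zero', Fin.mk_one, Fin.reduceFinMk]; assumption))

end L177

namespace L177
variable {a t : ℂ}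

/-! ### The values of `φ` -/

/-- The factors by which the parameters `y` of `cocycleTable` differ from the values of the
functionals `cocycleFunctional`. -/
def cocycleScale (a t : ℂ) (i j m : Fin 8) : ℂ :=
  if (i, j, m) = (1, 2, 0) ∨ (i, j, m) = (2, 6, 3) then a
  else if (i, j, m) = (5, 6, 3) then a * t
  else if (i, j, m) = (4, 7, 7) ∨ (i, j, m) = (5, 6, 6) ∨ (i, j, m) = (5, 6, 7) then t
  else if (i, j, m) = (3, 5, 5) ∨ (i, j, m) = (4, 5, 1) then 2
  else 1

theorem cocycleScale_ne_zero (ha : a ≠ 0) (ht : t ≠ 0) (i j m : Fin 8) :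
    cocycleScale a t i j m ≠ 0 := by
  unfold cocycleScale
  split_ifs
  exacts [ha, mul_ne_zero ha ht, ht, two_ne_zero, one_ne_zero]

/-- The coordinate functionals on the alternating bilinear maps, with those of labels `(0, 4, 0)` and
`(1, 2, 0)` replaced by combinations for which no degenerate case occurs. -/
noncomputable def cocycleFunctional (a : ℂ) (p : Fin 8 × Fin 8 × Fin 8) :
    LieModule.Cohomology.twoCochain ℂ (L177 a) (L177 a) →ₗ[ℂ] ℂ :=
  if p = (0, 4, 0) then cochainFunctional a (0, 4, 0) + cochainFunctional a (2, 4, 2)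
  else if p = (1, 2, 0) then cochainFunctional a (1, 2, 0) + a • cochainFunctional a (1, 5, 2)
  else cochainFunctional a p

/-- The labels of the functionals that form a coordinate system on the twisted cocycles with parameter
`t ≠ 0`. -/
noncomputable def cocycleIndices (a t : ℂ) : Finset (Fin 8 × Fin 8 × Fin 8) :=
  (Finset.univ.filter fun p => isFree p.1 p.2.1 p.2.2) ∪ {(0, 4, 0)}
    ∪ (if t + a = 0 then {(1, 4, 5)} else ∅)
    ∪ (if t = 1 ∧ a = 1 then {(1, 4, 2)} else ∅)
    ∪ (if t = 1 then {(1, 2, 0), (1, 5, 0)} else ∅)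
    ∪ (if 2 * a * t = 1 - a then {(3, 5, 5)} else ∅)

theorem mem_cocycleIndices {p : Fin 8 × Fin 8 × Fin 8} : p ∈ cocycleIndices a t ↔
    isFree p.1 p.2.1 p.2.2 ∨ p = (0, 4, 0) ∨ (t + a = 0 ∧ p = (1, 4, 5)) ∨
      (t = 1 ∧ a = 1 ∧ p = (1, 4, 2)) ∨ (t = 1 ∧ (p = (1, 2, 0) ∨ p = (1, 5, 0))) ∨
      (2 * a * t = 1 - a ∧ p = (3, 5, 5)) := by
  have h : ∀ (P : Prop) [Decidable P] (s : Finset (Fin 8 × Fin 8 × Fin 8)),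
      p ∈ (if P then s else ∅) ↔ P ∧ p ∈ s := by
    intro P _ s
    split_ifs with hP <;> simp [hP]
  simp only [cocycleIndices, Finset.mem_union, Finset.mem_filter, Finset.mem_univ, true_and,
    Finset.mem_singleton, Finset.mem_insert, h, or_assoc, and_assoc]

theorem ne_of_isFree {i j m : Fin 8} (h : isFree i j m) :
    (i, j, m) ≠ (0, 4, 0) ∧ (i, j, m) ≠ (1, 2, 0) := by
  constructor <;>
  · intro e
    simp only [Prod.mk.injEq] at e
    obtain ⟨rfl, rfl, rfl⟩ := e
    exact absurd h (by decide)

theorem card_cocycleIndices (a t : ℂ) : (cocycleIndices a t).card =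
    80 + (if t + a = 0 then 1 else 0) + (if t = 1 ∧ a = 1 then 1 else 0)
      + (if t = 1 then 2 else 0) + (if 2 * a * t = 1 - a then 1 else 0) := by
  unfold cocycleIndices
  split_ifs <;> decide +kernel

theorem eq_zero_of_cocycleFunctional_eq_zero (ha : a ≠ 0) (ht : t ≠ 0)
    (B : LieModule.Cohomology.twoCochain ℂ (L177 a) (L177 a))
    (hB : B ∈ twistedCocycle (L177 a) 1 1 1 t t t)
    (h : ∀ p ∈ cocycleIndices a t, cocycleFunctional a p B = 0) : B = 0 := by
  have h' : ∀ i j m, (i, j, m) ∈ cocycleIndices a t → (i, j, m) ≠ (0, 4, 0) →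
      (i, j, m) ≠ (1, 2, 0) → cochainCoord B i j m = 0 := by
    intro i j m hp h1 h2
    have := h _ hp
    rwa [cocycleFunctional, if_neg h1, if_neg h2] at this
  refine cochain_eq_zero B (eq_zero_of_free_eq_zero ha ht ?_ ?_ ?_ ?_ ?_ ?_ ?_ ?_)
  · rw [skewExt_cochainCoord]
    exact coordDefect_eq_zero hB
  · exact fun i j m hf => h' i j m (mem_cocycleIndices.mpr (.inl hf)) (ne_of_isFree hf).1
      (ne_of_isFree hf).2
  · exact h (0, 4, 0) (by simp [mem_cocycleIndices])
  · exact fun e => h' 1 4 5 (by simp [mem_cocycleIndices, e]) (by decide) (by decide)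
  · exact fun e e' => h' 1 4 2 (by simp [mem_cocycleIndices, e, e']) (by decide) (by decide)
  · exact fun e => h' 1 5 0 (by simp [mem_cocycleIndices, e]) (by decide) (by decide)
  · exact fun e => h' 3 5 5 (by simp [mem_cocycleIndices, e]) (by decide) (by decide)
  · intro e
    exact h (1, 2, 0) (by simp [mem_cocycleIndices, e])

set_option maxHeartbeats 4000000 in
theorem exists_cocycle_of_values (ha : a ≠ 0) (ht : t ≠ 0) (z : Fin 8 × Fin 8 × Fin 8 → ℂ)
    (hz : ∀ p ∉ cocycleIndices a t, z p = 0) :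
    ∃ B ∈ twistedCocycle (L177 a) 1 1 1 t t t,
      ∀ p ∈ cocycleIndices a t, cocycleFunctional a p B = z p := by
  obtain ⟨y, hy⟩ : ∃ y : Fin 8 → Fin 8 → Fin 8 → ℂ,
      ∀ i j m, cocycleScale a t i j m * y i j m = z (i, j, m) :=
    ⟨fun i j m => z (i, j, m) / cocycleScale a t i j m,
      fun i j m => mul_div_cancel₀ _ (cocycleScale_ne_zero ha ht i j m)⟩
  have hy' : ∀ i j m, (i, j, m) ∉ cocycleIndices a t → y i j m = 0 := fun i j m h =>
    (mul_eq_zero.mp ((hy i j m).trans (hz _ h))).resolve_left (cocycleScale_ne_zero ha ht i j m)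
  -- With `w = y 0 4 0 - u`, the two conditions on `u`, `v`, `w` become a linear system for `u` and
  -- `v`; it is solved so that the combination which `t ≠ 1` forces to vanish is `y 1 2 0`.
  obtain ⟨u, hu⟩ : ∃ u, 2 * u = (1 - a) * y 1 2 0 + (1 + t) / 2 * y 0 4 0
      + (3 - (t + a) / 2) * y 4 5 5 - (2 - a) * y 4 7 7 - (1 - a - a * t) * y 5 6 3 :=
    ⟨_, mul_div_cancel₀ _ two_ne_zero⟩
  obtain ⟨v, hv⟩ : ∃ v, v = a * y 1 2 0 + u - (1 + t) / 2 * y 0 4 0 + (t + a) / 2 * y 4 5 5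
      + (1 - a) * y 4 7 7 - a * t * y 5 6 3 := ⟨_, rfl⟩
  have hq : u + v - 3 * y 4 5 5 + y 4 7 7 + (1 - a) * y 5 6 3 = y 1 2 0 := by
    linear_combination hu + hv
  have hmul : ∀ (r : ℂ) (i j m : Fin 8), ((i, j, m) ∈ cocycleIndices a t → r = 0) →
      r * y i j m = 0 := by
    intro r i j m h
    by_cases hp : (i, j, m) ∈ cocycleIndices a t
    · rw [h hp, zero_mul]
    · rw [hy' i j m hp, mul_zero]
  refine ⟨cochainOf a (cocycleTable a t u v (y 0 4 0 - u) y), mem_twistedCocycle_of_lt ?_, ?_⟩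
  · rw [cochainCoord_cochainOf]
    apply coordDefect_cocycleTable
    · exact hmul _ _ _ _ fun h => by simpa [mem_cocycleIndices, isFree] using h
    · exact hmul _ _ _ _ fun h => by simp [mem_cocycleIndices, isFree] at h; grind
    · exact hmul _ _ _ _ fun h => by simp [mem_cocycleIndices, isFree] at h; grind
    · exact hmul _ _ _ _ fun h => by simp [mem_cocycleIndices, isFree] at h; grind
    · exact hmul _ _ _ _ fun h => by simp [mem_cocycleIndices, isFree] at h; grind
    · rw [hq]
      exact hmul _ _ _ _ fun h => by simp [mem_cocycleIndices, isFree] at h; grind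
    · rw [hq]
      linear_combination (-2) * hv
  · have hF : ∀ i j m, (i, j, m) ≠ (0, 4, 0) → (i, j, m) ≠ (1, 2, 0) →
        skewExt (cocycleTable a t u v (y 0 4 0 - u) y) i j m = z (i, j, m) →
        cocycleFunctional a (i, j, m) (cochainOf a (cocycleTable a t u v (y 0 4 0 - u) y)) =
          z (i, j, m) := by
      intro i j m h1 h2 h
      rw [cocycleFunctional, if_neg h1, if_neg h2, ← h, ← cochainCoord_cochainOf (a := a)]
      rfl
    have hfree : ∀ i j m, isFree i j m →
        skewExt (cocycleTable a t u v (y 0 4 0 - u) y) i j m = z (i, j, m) := by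
      intro i j m hf
      rw [← hy i j m]
      fin_cases i <;> fin_cases j <;> fin_cases m <;> first
        | exact absurd hf (by decide)
        | (simp (decide := true) only [skewExt, cocycleTable, cocycleScale, Fin.mk_zero',
            Fin.mk_one, Fin.reduceFinMk, ↓Matrix.cons_val, if_true, if_false]
           try ring1)
    rintro ⟨i, j, m⟩ hp
    rcases mem_cocycleIndices.mp hp with hf | h | ⟨-, h⟩ | ⟨-, -, h⟩ | ⟨-, h | h⟩ | ⟨-, h⟩
    · exact hF i j m (ne_of_isFree hf).1 (ne_of_isFree hf).2 (hfree i j m hf)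
    all_goals
      obtain ⟨rfl, rfl, rfl⟩ : i = _ ∧ j = _ ∧ m = _ := by simpa only [Prod.mk.injEq] using h
    · have h := hy 0 4 0
      simp (decide := true) only [cocycleScale, if_false] at h
      rw [cocycleFunctional, if_pos rfl, ← h]
      change cochainCoord (cochainOf a _) 0 4 0 + cochainCoord (cochainOf a _) 2 4 2 = _
      rw [cochainCoord_cochainOf]
      simp (decide := true) only [skewExt, cocycleTable, ↓Matrix.cons_val, if_true]
      ring
    · have h := hy 1 4 5
      simp (decide := true) only [cocycleScale, if_false] at h
      refine hF _ _ _ (by decide) (by decide) ?_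
      simp (decide := true) only [skewExt, cocycleTable, ↓Matrix.cons_val, if_true]
      linear_combination h
    · have h := hy 1 4 2
      simp (decide := true) only [cocycleScale, if_false] at h
      refine hF _ _ _ (by decide) (by decide) ?_
      simp (decide := true) only [skewExt, cocycleTable, ↓Matrix.cons_val, if_true]
      linear_combination h
    · have h := hy 1 2 0
      simp (decide := true) only [cocycleScale, if_true] at h
      rw [cocycleFunctional, if_neg (by decide), if_pos rfl]
      change cochainCoord (cochainOf a _) 1 2 0 + a * cochainCoord (cochainOf a _) 1 5 2 = _
      rw [cochainCoord_cochainOf]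
      simp (decide := true) only [skewExt, cocycleTable, ↓Matrix.cons_val, if_true]
      linear_combination h + a * hq
    · have h := hy 1 5 0
      simp (decide := true) only [cocycleScale, if_false] at h
      refine hF _ _ _ (by decide) (by decide) ?_
      simp (decide := true) only [skewExt, cocycleTable, ↓Matrix.cons_val, if_true]
      linear_combination h
    · have h := hy 3 5 5
      simp (decide := true) only [cocycleScale, if_true, if_false] at h
      refine hF _ _ _ (by decide) (by decide) ?_
      simp (decide := true) only [skewExt, cocycleTable, ↓Matrix.cons_val, if_true]
      linear_combination h

end L177

namespace L177
variable {a t : ℂ}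

/-- The value of `φ` off the origin. -/
theorem invPhi_of_ne_zero (ha : a ≠ 0) (ht : t ≠ 0) : invPhi (L177 a) t =
    80 + (if t + a = 0 then 1 else 0) + (if t = 1 ∧ a = 1 then 1 else 0)
      + (if t = 1 then 2 else 0) + (if 2 * a * t = 1 - a then 1 else 0) := by
  have h := finrank_eq_card_of_functionals
    (M := LieModule.Cohomology.twoCochain ℂ (L177 a) (L177 a)) (twistedCocycle (L177 a) 1 1 1 t t t)
    (cocycleFunctional a) (cocycleIndices a t) (eq_zero_of_cocycleFunctional_eq_zero ha ht)
    (exists_cocycle_of_values ha ht)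
  exact h.trans (card_cocycleIndices a t)


/-- The labels of the coordinates that form a coordinate system on the twisted cocycles with
parameter `0`. -/
noncomputable def zeroIndices (a : ℂ) : Finset ((Fin 8 × Fin 8) × Fin 8) :=
  ({(0, 1), (0, 2), (0, 3), (0, 4), (0, 5), (1, 2), (1, 3), (1, 4), (1, 5), (2, 4), (2, 5), (3, 5),
    (4, 5)} ∪ (if a = 1 then {(3, 4)} else ∅)) ×ˢ Finset.univ

theorem card_zeroIndices (a : ℂ) : (zeroIndices a).card = 104 + if a = 1 then 8 else 0 := by
  unfold zeroIndices
  rw [Finset.card_product]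
  split_ifs <;> rfl

/-- A twisted cocycle with parameter `0` is determined by the values `B(lᵢ, lⱼ)` listed in `zeroIndices`.
For each `m`, the identities for the `m`-th coordinate are linear equations in the 28 entries
`c i j m`. -/
theorem eq_zero_of_zeroIndices {c : Fin 8 → Fin 8 → Fin 8 → ℂ} (ha : a ≠ 0)
    (E : ∀ i j k m, coordDefect a 0 (skewExt c) i j k m = 0)
    (h : ∀ i j m, ((i, j), m) ∈ zeroIndices a → c i j m = 0)
    (i j : Fin 8) (hij : i < j) (m : Fin 8) : c i j m = 0 := by
  have hb : ∀ i j, (i, j) ∈ ({(0, 1), (0, 2), (0, 3), (0, 4), (0, 5), (1, 2), (1, 3), (1, 4),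
      (1, 5), (2, 4), (2, 5), (3, 5), (4, 5)} : Finset (Fin 8 × Fin 8)) → ∀ m, c i j m = 0 :=
    fun i j hij m => h i j m (Finset.mem_product.mpr ⟨Finset.mem_union_left _ hij,
      Finset.mem_univ _⟩)
  have h34 : a = 1 → c 3 4 m = 0 := fun e => h 3 4 m (by simp [zeroIndices, e])
  obtain ⟨z34, z06, z07, z16, z17, z23, z26, z27, z36, z37, z46, z47, z56, z57, z67⟩ :
      c 3 4 m = 0 ∧ c 0 6 m = 0 ∧ c 0 7 m = 0 ∧ c 1 6 m = 0 ∧ c 1 7 m = 0 ∧ c 2 3 m = 0 ∧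
      c 2 6 m = 0 ∧ c 2 7 m = 0 ∧ c 3 6 m = 0 ∧ c 3 7 m = 0 ∧ c 4 6 m = 0 ∧ c 4 7 m = 0 ∧
      c 5 6 m = 0 ∧ c 5 7 m = 0 ∧ c 6 7 m = 0 := by
    have e0 := E 0 1 2 m; have e1 := E 0 1 3 m; have e2 := E 0 1 4 m; have e3 := E 0 1 5 m
    have e4 := E 0 2 3 m; have e5 := E 0 2 4 m; have e6 := E 0 2 5 m; have e7 := E 0 2 6 m
    have e8 := E 0 2 7 m; have e9 := E 0 3 5 m; have e10 := E 0 4 5 m; have e11 := E 0 5 6 m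
    have e12 := E 0 5 7 m; have e13 := E 1 2 5 m; have e14 := E 0 3 6 m
    simp (decide := true) only [coordDefect, atLie, skewExt, hb, if_true, if_false,
      ↓Matrix.cons_val, Pi.zero_apply, mul_zero, zero_mul, add_zero, zero_add, neg_zero]
      at e0 e1 e2 e3 e4 e5 e6 e7 e8 e9 e10 e11 e12 e13 e14
    -- The only entry that is arbitrary for `a = 1` and forced to vanish otherwise.
    have k1 : (a - 1) * c 3 4 m = 0 := by grind
    have k2 : c 3 4 m = 0 := by
      rcases mul_eq_zero.mp k1 with k | k
      · exact h34 (sub_eq_zero.mp k)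
      · exact k
    grind
  fin_cases i <;> fin_cases j <;> first
    | exact absurd hij (by decide)
    | exact hb _ _ (by decide) m
    | assumption

set_option maxHeartbeats 1000000 in
/-- The value of `φ` at the origin. -/
theorem invPhi_zero (ha : a ≠ 0) : invPhi (L177 a) 0 = 104 + if a = 1 then 8 else 0 := by
  have key := finrank_eq_card_of_functionals
    (M := LieModule.Cohomology.twoCochain ℂ (L177 a) (L177 a)) (twistedCocycle (L177 a) 1 1 1 0 0 0)
    (fun p : (Fin 8 × Fin 8) × Fin 8 => cochainFunctional a (p.1.1, p.1.2, p.2))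
    (zeroIndices a) ?_ ?_
  · exact key.trans (card_zeroIndices a)
  · intro B hB h
    refine cochain_eq_zero B (eq_zero_of_zeroIndices ha ?_ fun i j m hp => h ((i, j), m) hp)
    rw [skewExt_cochainCoord]
    exact coordDefect_eq_zero hB
  · intro z hz
    refine ⟨cochainOf a (cocycleTableZero a fun i j m => z ((i, j), m)),
      mem_twistedCocycle_of_lt ?_, ?_⟩
    · rw [cochainCoord_cochainOf]
      refine coordDefect_cocycleTableZero fun m => ?_
      by_cases h : a = 1
      · rw [h, sub_self, zero_mul]
      · rw [hz _ (by simp [zeroIndices, h]), mul_zero]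
    · rintro ⟨⟨i, j⟩, m⟩ hp
      change cochainCoord (cochainOf a _) i j m = _
      rw [cochainCoord_cochainOf]
      obtain ⟨hp, -⟩ := Finset.mem_product.mp hp
      have hp' : (i, j) ∈ ({(0, 1), (0, 2), (0, 3), (0, 4), (0, 5), (1, 2), (1, 3), (1, 4),
          (1, 5), (2, 4), (2, 5), (3, 5), (4, 5)} ∪ {(3, 4)} : Finset (Fin 8 × Fin 8)) :=
        Finset.union_subset_union_right (by split_ifs <;> simp) hp
      clear hp
      fin_cases i <;> fin_cases j <;> first
        | exact absurd hp' (by decide)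
        | rfl
end L177

namespace L177
variable {a t : ℂ}

/-! ### The values of `ψ` -/

/-- The coordinates of the vectors `A(lᵢ)`. -/
noncomputable def endCoord (A : L177 a →ₗ[ℂ] L177 a) (i m : Fin 8) : ℂ := coord a (A (basis a i)) m

/-- The coordinates of `t A[lᵢ, lⱼ] - [A lᵢ, lⱼ] - [lᵢ, A lⱼ]`, in terms of the coordinates `b`
of `A`. -/
def derDefect (a t : ℂ) (b : Fin 8 → Fin 8 → ℂ) (i j m : Fin 8) : ℂ :=
  t * atLie a (fun l => b l m) i j + adCoord a (b i) j m - adCoord a (b j) i m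

theorem mem_genDer_iff_derDefect (A : L177 a →ₗ[ℂ] L177 a) : A ∈ genDer (L177 a) t 1 1 ↔
    ∀ i j, i < j → ∀ m, derDefect a t (endCoord A) i j m = 0 := by
  rw [mem_genDer_iff_basis t (basis a)]
  refine forall₃_congr fun i j _ => ?_
  rw [← (coord a).map_eq_zero_iff, funext_iff]
  refine forall_congr' fun m => Eq.congr_left ?_
  have hA : coord a (A ⁅basis a i, basis a j⁆) m =
      atLie a (fun l => coord a (A (basis a l)) m) i j :=
    map_lie_basis ((LinearMap.proj m).comp ((coord a).toLinearMap.comp A)) i j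
  rw [← lie_skew (A (basis a i))]
  simp only [map_sub, map_add, map_neg, map_smul, Pi.sub_apply, Pi.add_apply, Pi.neg_apply,
    Pi.smul_apply, smul_eq_mul, hA, coord_basis_lie]
  rw [derDefect]
  change _ = t * atLie a (fun l => coord a (A (basis a l)) m) i j
    + adCoord a (coord a (A (basis a i))) j m - adCoord a (coord a (A (basis a j))) i m
  ring

/-- The linear operator with prescribed coordinates on the basis. -/
noncomputable def endOf (a : ℂ) (b : Fin 8 → Fin 8 → ℂ) : L177 a →ₗ[ℂ] L177 a :=
  (basis a).constr ℂ fun i => (coord a).symm (b i)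

theorem endCoord_endOf (b : Fin 8 → Fin 8 → ℂ) : endCoord (endOf a b) = b := by
  funext i m
  simp [endCoord, endOf]

/-- The general `(t, 1, 1)`-derivation of `𝓛₁₇,₇(a)` in coordinates. The parameters `q`, `r`, `k`
are subject to the conditions of `derDefect_derTable`. -/
def derTable (a t w q r p k : ℂ) (x : Fin 8 → Fin 8 → ℂ) : Fin 8 → Fin 8 → ℂ :=
  ![![t ^ 2 * w + (t + 1) * q, -x 2 4 - a * t * x 4 6, t * (1 + a * t) * p, x 0 3, x 0 4, x 0 5,
      x 0 6, x 0 7],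
    ![0, 2 * t * w + (t + 1) ^ 2 * q, 0, x 0 5, t * (1 + a * t) * p, 0, x 1 6, x 1 7],
    ![0, -t * x 3 6, t ^ 2 * w - q, x 0 4 - a * t * x 4 7, x 2 4, 2 * a * t ^ 2 * p, x 2 6, x 2 7],
    ![0, 0, 0, 2 * t * w - (t + 1) * q, 0, 0, x 3 6, x 3 7],
    ![0, 0, 0, -2 * t * p, 2 * t * w + q, 0, x 4 6, x 4 7],
    ![0, 0, 0, t * x 3 7 + x 2 4 + a * t * x 4 6, t * x 3 6, t ^ 2 * w - (t + 1) ^ 2 * q, x 5 6,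
      x 5 7],
    ![0, 0, 0, 0, 0, 0, (t + 2) * w + r, (a * t - 1) * p],
    ![0, 0, 0, 0, 0, 0, k, (t + 2) * w]]

theorem derDefect_derTable {w q r p k : ℂ} {x : Fin 8 → Fin 8 → ℂ} (hk : t * k = 0)
    (hr : t * r = (t + 2) * q) (hq : (t - 1) * ((t + 2) * q) = 0) (i j m : Fin 8) (hij : i < j) :
    derDefect a t (derTable a t w q r p k x) i j m = 0 := by
  fin_cases i <;> fin_cases j <;> first
    | exact absurd hij (by decide)
    | (clear hij
       fin_cases m <;>
       simp only [derDefect, atLie, adCoord, derTable, Fin.mk_zero', Fin.mk_one, Fin.reduceFinMk,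
         ↓Matrix.cons_val, Pi.zero_apply] <;>
       first
       | ring1
       | grind)

/-- A `(t, 1, 1)`-derivation is determined by sixteen free coordinates, by two combinations that are
adapted to the degenerate values of `t`, and by further coordinates if `t` is `0` or `1`. -/
theorem eq_zero_of_derDefect {b : Fin 8 → Fin 8 → ℂ} (ha : a ≠ 0)
    (E : ∀ i j, i < j → ∀ m, derDefect a t b i j m = 0)
    (hx : b 0 3 = 0 ∧ b 0 4 = 0 ∧ b 0 5 = 0 ∧ b 0 6 = 0 ∧ b 0 7 = 0 ∧ b 1 6 = 0 ∧ b 1 7 = 0 ∧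
      b 2 4 = 0 ∧ b 2 6 = 0 ∧ b 2 7 = 0 ∧ b 3 6 = 0 ∧ b 3 7 = 0 ∧ b 4 6 = 0 ∧ b 4 7 = 0 ∧
      b 5 6 = 0 ∧ b 5 7 = 0)
    (h14 : a * b 1 4 = (a * t + 2) * b 6 7) (h77 : b 7 7 = 1 / 2 * b 4 4)
    (h76 : t = 0 → b 7 6 = 0) (h66 : t = 0 → b 6 6 = 0) (h44 : t = 1 → b 4 4 = 0)
    (i m : Fin 8) : b i m = 0 := by
  have e : ∀ i j m, i < j → derDefect a t b i j m = 0 := fun i j m h => E i j h m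
  simp only [derDefect] at e
  obtain ⟨x03, x04, x05, x06, x07, x16, x17, x24, x26, x27, x36, x37, x46, x47, x56, x57⟩ := hx
  obtain ⟨z65, z15, z75, z62, z12, z45, z63, z13⟩ : b 6 5 = 0 ∧ b 1 5 = 0 ∧ b 7 5 = 0 ∧
      b 6 2 = 0 ∧ b 1 2 = 0 ∧ b 4 5 = 0 ∧ b 6 3 = 0 ∧ b 1 3 = 0 := by
    have e0 := e 0 6 3 (by decide); have e1 := e 0 1 3 (by decide)
    have e2 := e 1 7 7 (by decide); have e3 := e 1 6 6 (by decide)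
    have e4 := e 0 1 4 (by decide); have e5 := e 1 4 7 (by decide)
    have e6 := e 0 6 7 (by decide); have e7 := e 0 1 7 (by decide)
    simp only [atLie, adCoord, ↓Matrix.cons_val, Pi.zero_apply] at e0 e1 e2 e3 e4 e5 e6 e7
    grind
  obtain ⟨z60, z72, z10, z35, z42, z64, z73⟩ : b 6 0 = 0 ∧ b 7 2 = 0 ∧ b 1 0 = 0 ∧
      b 3 5 = 0 ∧ b 4 2 = 0 ∧ b 6 4 = 0 ∧ b 7 3 = 0 := by
    have e0 := e 3 6 7 (by decide); have e1 := e 4 7 7 (by decide)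
    have e2 := e 0 6 6 (by decide); have e3 := e 0 7 7 (by decide)
    have e4 := e 1 2 4 (by decide); have e5 := e 1 3 7 (by decide)
    have e6 := e 1 4 6 (by decide)
    simp only [atLie, adCoord, ↓Matrix.cons_val, Pi.zero_apply] at e0 e1 e2 e3 e4 e5 e6
    grind
  have z67 : b 6 7 = 0 ∧ b 1 4 = 0 ∧ b 0 2 = 0 ∧ b 4 3 = 0 ∧ b 2 5 = 0 := by
    have e0 := e 0 1 6 (by decide); have e1 := e 0 2 3 (by decide)
    have e2 := e 0 4 7 (by decide); have e3 := e 1 2 7 (by decide)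
    simp only [atLie, adCoord, ↓Matrix.cons_val] at e0 e1 e2 e3
    -- The coefficient `2` does not depend on `a` and `t`: this is why the combination of `h14` is used.
    have k0 : 2 * b 6 7 = 0 := by grind
    grind
  obtain ⟨z67, z14, z02, z43, z25⟩ := z67
  obtain ⟨z70, z32, z40, z61, z74⟩ : b 7 0 = 0 ∧ b 3 2 = 0 ∧ b 4 0 = 0 ∧ b 6 1 = 0 ∧
      b 7 4 = 0 := by
    have e0 := e 3 7 7 (by decide); have e1 := e 0 7 6 (by decide)
    have e2 := e 1 3 6 (by decide); have e3 := e 2 6 6 (by decide)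
    have e4 := e 4 5 3 (by decide)
    simp only [atLie, adCoord, ↓Matrix.cons_val, Pi.zero_apply] at e0 e1 e2 e3 e4
    grind
  obtain ⟨z00, z11, z22, z33, z44, z55, z66, z77⟩ : b 0 0 = 0 ∧ b 1 1 = 0 ∧ b 2 2 = 0 ∧
      b 3 3 = 0 ∧ b 4 4 = 0 ∧ b 5 5 = 0 ∧ b 6 6 = 0 ∧ b 7 7 = 0 := by
    have e0 := e 0 2 4 (by decide); have e1 := e 0 3 7 (by decide)
    have e2 := e 0 4 6 (by decide); have e3 := e 0 5 3 (by decide)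
    have e4 := e 1 2 6 (by decide); have e5 := e 1 5 7 (by decide)
    have e6 := e 2 4 7 (by decide)
    simp only [atLie, adCoord, ↓Matrix.cons_val] at e0 e1 e2 e3 e4 e5 e6
    have e0' : b 0 0 + b 2 2 - t * b 4 4 = 0 := by
      apply mul_left_cancel₀ ha
      linear_combination e0
    -- By the choice of the combination `h77`, a factor `t + 2` drops out of this relation.
    have k : (t - 1) * b 4 4 = 0 := by grind
    have z44 : b 4 4 = 0 := by
      rcases mul_eq_zero.mp k with k | k
      · exact h44 (sub_eq_zero.mp k)
      · exact k
    have k' : t * b 6 6 = 0 := by grind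
    have z66 : b 6 6 = 0 := by
      rcases mul_eq_zero.mp k' with k | k
      · exact h66 k
      · exact k
    grind
  obtain ⟨z23, z71, z30, z20, z34, z41, z52, z76⟩ : b 2 3 = 0 ∧ b 7 1 = 0 ∧ b 3 0 = 0 ∧
      b 2 0 = 0 ∧ b 3 4 = 0 ∧ b 4 1 = 0 ∧ b 5 2 = 0 ∧ b 7 6 = 0 := by
    have e0 := e 0 2 7 (by decide); have e1 := e 2 7 6 (by decide)
    have e2 := e 3 4 6 (by decide); have e3 := e 2 5 3 (by decide)
    have e4 := e 2 3 7 (by decide); have e5 := e 0 5 4 (by decide)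
    have e6 := e 4 5 7 (by decide); have e7 := e 2 4 6 (by decide)
    simp only [atLie, adCoord, ↓Matrix.cons_val, Pi.zero_apply] at e0 e1 e2 e3 e4 e5 e6 e7
    have z52 : b 5 2 = 0 := by grind
    have k : t * b 7 6 = 0 := by grind
    have z76 : b 7 6 = 0 := by
      rcases mul_eq_zero.mp k with k | k
      · exact h76 k
      · exact k
    grind
  obtain ⟨z01, z53, z31, z50, z54, z21, z51⟩ : b 0 1 = 0 ∧ b 5 3 = 0 ∧ b 3 1 = 0 ∧
      b 5 0 = 0 ∧ b 5 4 = 0 ∧ b 2 1 = 0 ∧ b 5 1 = 0 := by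
    have e0 := e 0 2 6 (by decide); have e1 := e 0 5 7 (by decide)
    have e2 := e 2 3 6 (by decide); have e3 := e 4 5 6 (by decide)
    have e4 := e 0 5 6 (by decide); have e5 := e 2 5 7 (by decide)
    have e6 := e 2 5 6 (by decide)
    simp only [atLie, adCoord, ↓Matrix.cons_val] at e0 e1 e2 e3 e4 e5 e6
    grind
  fin_cases i <;> fin_cases m <;> assumption

/-- The coordinate functional `A ↦ A(lᵢ)ₘ`, labelled by the pair `(i, m)`. -/
noncomputable def endFunctional (a : ℂ) (p : Fin 8 × Fin 8) : (L177 a →ₗ[ℂ] L177 a) →ₗ[ℂ] ℂ where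
  toFun A := endCoord A p.1 p.2
  map_add' _ _ := rfl
  map_smul' _ _ := rfl

/-- The labels of sixteen coordinates that are arbitrary for every `t`. -/
def derFree : Finset (Fin 8 × Fin 8) :=
  {(0, 3), (0, 4), (0, 5), (0, 6), (0, 7), (1, 6), (1, 7), (2, 4), (2, 6), (2, 7), (3, 6), (3, 7),
    (4, 6), (4, 7), (5, 6), (5, 7)}

/-- The coordinate functionals on the operators, with those of labels `(1, 4)` and `(7, 7)` replaced
by combinations that do not vanish on the `(t, 1, 1)`-derivations for any `t`. -/
noncomputable def derFunctional (a t : ℂ) (p : Fin 8 × Fin 8) :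
    (L177 a →ₗ[ℂ] L177 a) →ₗ[ℂ] ℂ :=
  if p = (1, 4) then a • endFunctional a (1, 4) - (a * t + 2) • endFunctional a (6, 7)
  else if p = (7, 7) then endFunctional a (7, 7) - (1 / 2 : ℂ) • endFunctional a (4, 4)
  else endFunctional a p

/-- The labels of the functionals that form a coordinate system on the `(t, 1, 1)`-derivations. -/
noncomputable def derIndices (t : ℂ) : Finset (Fin 8 × Fin 8) :=
  derFree ∪ {(1, 4), (7, 7)} ∪ (if t = 0 then {(6, 6), (7, 6)} else ∅)
    ∪ (if t = 1 then {(4, 4)} else ∅)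

theorem card_derIndices (t : ℂ) : (derIndices t).card =
    18 + (if t = 0 then 2 else 0) + (if t = 1 then 1 else 0) := by
  unfold derIndices
  split_ifs <;> decide +kernel

theorem mem_derIndices {p : Fin 8 × Fin 8} : p ∈ derIndices t ↔
    p ∈ derFree ∨ p = (1, 4) ∨ p = (7, 7) ∨ (t = 0 ∧ (p = (6, 6) ∨ p = (7, 6))) ∨
      (t = 1 ∧ p = (4, 4)) := by
  have h : ∀ (P : Prop) [Decidable P] (s : Finset (Fin 8 × Fin 8)),
      p ∈ (if P then s else ∅) ↔ P ∧ p ∈ s := by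
    intro P _ s
    split_ifs with hP <;> simp [hP]
  simp only [derIndices, Finset.mem_union, Finset.mem_singleton, Finset.mem_insert, h, or_assoc]

theorem eq_zero_of_derFunctional_eq_zero (ha : a ≠ 0) (A : L177 a →ₗ[ℂ] L177 a)
    (hA : A ∈ genDer (L177 a) t 1 1) (h : ∀ p ∈ derIndices t, derFunctional a t p A = 0) :
    A = 0 := by
  have h' : ∀ i m, (i, m) ∈ derIndices t → (i, m) ≠ (1, 4) → (i, m) ≠ (7, 7) →
      endCoord A i m = 0 := by
    intro i m hp h1 h2
    have := h _ hp
    rwa [derFunctional, if_neg h1, if_neg h2] at this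
  have hf : ∀ i m, (i, m) ∈ derFree → endCoord A i m = 0 := by
    intro i m hp
    refine h' i m (mem_derIndices.mpr (.inl hp)) ?_ ?_ <;>
    · intro e
      rw [e] at hp
      exact absurd hp (by decide)
  have h0 : ∀ i m, endCoord A i m = 0 := by
    refine eq_zero_of_derDefect ha ((mem_genDer_iff_derDefect A).mp hA) ?_ ?_ ?_ ?_ ?_ ?_
    · refine ⟨?_, ?_, ?_, ?_, ?_, ?_, ?_, ?_, ?_, ?_, ?_, ?_, ?_, ?_, ?_, ?_⟩ <;>
        exact hf _ _ (by decide)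
    · have := h (1, 4) (by simp [mem_derIndices])
      exact sub_eq_zero.mp this
    · have := h (7, 7) (by simp [mem_derIndices])
      exact sub_eq_zero.mp this
    · exact fun e => h' 7 6 (by simp [mem_derIndices, e]) (by decide) (by decide)
    · exact fun e => h' 6 6 (by simp [mem_derIndices, e]) (by decide) (by decide)
    · exact fun e => h' 4 4 (by simp [mem_derIndices, e]) (by decide) (by decide)
  refine (basis a).ext fun i => (coord a).injective ?_
  ext m
  rw [LinearMap.zero_apply, map_zero]
  exact h0 i m

theorem exists_derivation_of_values (z : Fin 8 × Fin 8 → ℂ) :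
    ∃ A ∈ genDer (L177 a) t 1 1, ∀ p ∈ derIndices t, derFunctional a t p A = z p := by
  obtain ⟨w, q, r, k, hk, hr, hq, h77, h66, h76, h44⟩ : ∃ w q r k : ℂ, t * k = 0 ∧
      t * r = (t + 2) * q ∧ (t - 1) * ((t + 2) * q) = 0 ∧
      (t + 2) * w - 1 / 2 * (2 * t * w + q) = z (7, 7) ∧
      (t = 0 → (t + 2) * w + r = z (6, 6)) ∧ (t = 0 → k = z (7, 6)) ∧
      (t = 1 → 2 * t * w + q = z (4, 4)) := by
    by_cases h0 : t = 0
    · subst h0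
      refine ⟨z (7, 7) / 2, 0, z (6, 6) - z (7, 7), z (7, 6), ?_, ?_, ?_, ?_, ?_, ?_, ?_⟩ <;>
        first
        | ring1
        | (intro _; ring1)
        | (intro e; exact absurd e (by norm_num))
    by_cases h1 : t = 1
    · subst h1
      refine ⟨(2 * z (7, 7) + z (4, 4)) / 6, 2 / 3 * (z (4, 4) - z (7, 7)),
        2 * (z (4, 4) - z (7, 7)), 0, ?_, ?_, ?_, ?_, ?_, ?_, ?_⟩ <;>
        first
        | ring1
        | (intro _; ring1)
        | (intro e; exact absurd e (by norm_num))
    · exact ⟨z (7, 7) / 2, 0, 0, 0, by ring, by ring, by ring, by ring, fun e => absurd e h0,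
        fun e => absurd e h0, fun e => absurd e h1⟩
  refine ⟨endOf a (derTable a t w q r (z (1, 4) / 2) k fun i m => z (i, m)),
    (mem_genDer_iff_derDefect _).mpr ?_, ?_⟩
  · rw [endCoord_endOf]
    exact fun i j hij m => derDefect_derTable hk hr hq i j m hij
  · have hF : ∀ i m, (i, m) ≠ (1, 4) → (i, m) ≠ (7, 7) →
        derTable a t w q r (z (1, 4) / 2) k (fun i m => z (i, m)) i m = z (i, m) →
        derFunctional a t (i, m)
          (endOf a (derTable a t w q r (z (1, 4) / 2) k fun i m => z (i, m))) = z (i, m) := by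
      intro i m h1 h2 h
      rw [derFunctional, if_neg h1, if_neg h2]
      exact (congrFun (congrFun (endCoord_endOf _) i) m).trans h
    rintro p hp
    rcases mem_derIndices.mp hp with hp | rfl | rfl | ⟨h0, rfl | rfl⟩ | ⟨h1, rfl⟩
    · simp only [derFree, Finset.mem_insert, Finset.mem_singleton] at hp
      rcases hp with rfl | rfl | rfl | rfl | rfl | rfl | rfl | rfl | rfl | rfl | rfl | rfl | rfl |
        rfl | rfl | rfl <;> exact hF _ _ (by decide) (by decide) rfl
    · rw [derFunctional, if_pos rfl]
      change a * endCoord _ 1 4 - (a * t + 2) * endCoord _ 6 7 = _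
      rw [endCoord_endOf]
      simp only [derTable, ↓Matrix.cons_val]
      ring
    · rw [derFunctional, if_neg (by decide), if_pos rfl, ← h77]
      change endCoord _ 7 7 - 1 / 2 * endCoord _ 4 4 = _
      rw [endCoord_endOf]
      simp only [derTable, ↓Matrix.cons_val]
    · exact hF 6 6 (by decide) (by decide) (h66 h0)
    · exact hF 7 6 (by decide) (by decide) (h76 h0)
    · exact hF 4 4 (by decide) (by decide) (h44 h1)

/-- The values of `ψ`. -/
theorem invPsi_eq (ha : a ≠ 0) (t : ℂ) : invPsi (L177 a) t =
    18 + (if t = 0 then 2 else 0) + (if t = 1 then 1 else 0) := by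
  have h := finrank_eq_card_of_functionals (genDer (L177 a) t 1 1) (derFunctional a t)
    (derIndices t) (eq_zero_of_derFunctional_eq_zero ha)
    (fun z _ => exists_derivation_of_values z)
  exact h.trans (card_derIndices t)

end L177

/-! ### Invariance of `φ` under isomorphisms -/

section Transport

variable {L L' : Type*} [LieRing L] [LieAlgebra ℂ L] [LieRing L'] [LieAlgebra ℂ L']

/-- The transport `B ↦ f(B(f⁻¹ x, f⁻¹ y))` of alternating bilinear maps along an isomorphism `f`. -/
noncomputable def twoCochainTransport (f : L ≃ₗ⁅ℂ⁆ L') :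
    LieModule.Cohomology.twoCochain ℂ L L →ₗ[ℂ] LieModule.Cohomology.twoCochain ℂ L' L' where
  toFun B :=
    { val := (B.1.compl₁₂ (f.symm.toLinearEquiv : L' →ₗ[ℂ] L)
        (f.symm.toLinearEquiv : L' →ₗ[ℂ] L)).compr₂ (f.toLinearEquiv : L →ₗ[ℂ] L')
      property := fun x => by
        change f (B.1 (f.symm x) (f.symm x)) = 0
        rw [B.2 (f.symm x), map_zero] }
  map_add' B C := by
    ext x y
    exact map_add f _ _
  map_smul' c B := by
    ext x y
    exact map_smul f _ _

theorem twoCochainTransport_apply (f : L ≃ₗ⁅ℂ⁆ L')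
    (B : LieModule.Cohomology.twoCochain ℂ L L) (x y : L') :
    twoCochainTransport f B x y = f (B (f.symm x) (f.symm y)) := rfl

theorem twoCochainTransport_injective (f : L ≃ₗ⁅ℂ⁆ L') :
    Function.Injective (twoCochainTransport f) := by
  intro B C h
  ext x y
  have := congrArg (fun D : LieModule.Cohomology.twoCochain ℂ L' L' => D (f x) (f y)) h
  simpa [twoCochainTransport_apply] using this

theorem twoCochainTransport_mem (f : L ≃ₗ⁅ℂ⁆ L') {α : ℂ}
    {B : LieModule.Cohomology.twoCochain ℂ L L} (hB : B ∈ twistedCocycle L 1 1 1 α α α) :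
    twoCochainTransport f B ∈ twistedCocycle L' 1 1 1 α α α := by
  rw [mem_twistedCocycle_iff_defect] at hB ⊢
  intro x y z
  have h := congrArg f (hB (f.symm x) (f.symm y) (f.symm z))
  simpa [twistedDefect, twoCochainTransport_apply, LieEquiv.map_lie] using h

theorem invPhi_le_of_equiv [FiniteDimensional ℂ L'] (f : L ≃ₗ⁅ℂ⁆ L') (α : ℂ) :
    invPhi L α ≤ invPhi L' α :=
  LinearMap.finrank_le_finrank_of_injective
    (f := (twoCochainTransport f).restrict fun _ hB => twoCochainTransport_mem f hB)
    fun _ _ h => Subtype.ext (twoCochainTransport_injective f (congrArg Subtype.val h))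

theorem invPhi_eq_of_equiv [FiniteDimensional ℂ L] [FiniteDimensional ℂ L'] (f : L ≃ₗ⁅ℂ⁆ L') :
    invPhi L = invPhi L' :=
  funext fun α => le_antisymm (invPhi_le_of_equiv f α) (invPhi_le_of_equiv f.symm α)

end Transport

namespace L177

/-! ### The function `φ` determines the parameter -/

instance (a : ℂ) : FiniteDimensional ℂ (L177 a) := Module.Basis.finiteDimensional_of_finite (basis a)

/-- The value at `0` singles out `a = 1`. For `a ≠ 1`, the exceptional arguments `-a` and
`(1 - a) / (2 a)`, counted with multiplicity, can be read off from `φ`. If they are the same for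
`a'` and `a ≠ a'`, then `-a = (1 - a') / (2 a')` and `-a' = (1 - a) / (2 a)`, whence
`1 - a' = -2 a a' = 1 - a`. -/
theorem invPhi_injective {a a' : ℂ} (ha : a ≠ 0) (ha' : a' ≠ 0)
    (h : invPhi (L177 a) = invPhi (L177 a')) : a = a' := by
  have h0 := congrFun h 0
  rw [invPhi_zero ha, invPhi_zero ha'] at h0
  by_cases h1 : a = 1
  · by_cases h1' : a' = 1
    · rw [h1, h1']
    · simp [h1, h1'] at h0
  by_cases h1' : a' = 1
  · simp [h1, h1'] at h0
  by_contra hne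
  -- Comparing the two functions at `-b`: it is exceptional for `c` as well, and is not `-c`.
  have key : ∀ {b c : ℂ}, b ≠ 0 → c ≠ 0 → b ≠ 1 → c ≠ 1 → b ≠ c →
      invPhi (L177 b) = invPhi (L177 c) → 2 * c * -b = 1 - c := by
    intro b c hb hc hb1 hc1 hbc hbc'
    by_contra hk
    have hs : -b + c ≠ 0 := fun e => hbc (by linear_combination -e)
    have e := congrFun hbc' (-b)
    rw [invPhi_of_ne_zero hb (neg_ne_zero.mpr hb), invPhi_of_ne_zero hc (neg_ne_zero.mpr hb),
      if_pos (neg_add_cancel b), if_neg (fun h : -b = 1 ∧ b = 1 => hb1 h.2), if_neg hs,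
      if_neg (fun h : -b = 1 ∧ c = 1 => hc1 h.2), if_neg hk] at e
    omega
  have k := key ha ha' h1 h1' hne h
  have k' := key ha' ha h1' h1 (Ne.symm hne) h.symm
  exact hne (by linear_combination k' - k)

theorem eq_of_equiv {a a' : ℂ} (ha : a ≠ 0) (ha' : a' ≠ 0) (f : L177 a ≃ₗ⁅ℂ⁆ L177 a') : a = a' :=
  invPhi_injective ha ha' (invPhi_eq_of_equiv f)

/-! ### The table of values of `φ` -/

theorem invPhi_one_values : invPhi (L177 1) 0 = 112 ∧ invPhi (L177 1) 1 = 83 ∧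
    invPhi (L177 1) (-1) = 81 ∧
    ∀ α : ℂ, α ≠ 0 → α ≠ 1 → α ≠ -1 → invPhi (L177 1) α = 80 := by
  refine ⟨?_, ?_, ?_, fun α h0 h1 h2 => ?_⟩
  · rw [invPhi_zero one_ne_zero, if_pos rfl]
  · rw [invPhi_of_ne_zero one_ne_zero one_ne_zero]
    norm_num
  · rw [invPhi_of_ne_zero one_ne_zero (neg_ne_zero.mpr one_ne_zero)]
    norm_num
  · rw [invPhi_of_ne_zero one_ne_zero h0, if_neg (fun h => h2 (by linear_combination h)),
      if_neg (fun h => h1 h.1), if_neg h1, if_neg (fun h => h0 (by linear_combination h / 2))]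

theorem invPhi_neg_one_values : invPhi (L177 (-1)) 0 = 104 ∧ invPhi (L177 (-1)) 1 = 83 ∧
    invPhi (L177 (-1)) (-1) = 81 ∧
    ∀ α : ℂ, α ≠ 0 → α ≠ 1 → α ≠ -1 → invPhi (L177 (-1)) α = 80 := by
  have ha : (-1 : ℂ) ≠ 0 := neg_ne_zero.mpr one_ne_zero
  refine ⟨?_, ?_, ?_, fun α h0 h1 h2 => ?_⟩
  · rw [invPhi_zero ha]
    norm_num
  · rw [invPhi_of_ne_zero ha one_ne_zero]
    norm_num
  · rw [invPhi_of_ne_zero ha ha]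
    norm_num
  · rw [invPhi_of_ne_zero ha h0, if_neg (fun h => h1 (by linear_combination h)),
      if_neg (fun h => h1 h.1), if_neg h1, if_neg (fun h => h2 (by linear_combination -h / 2))]

theorem invPhi_third_values : invPhi (L177 (1 / 3)) 0 = 104 ∧ invPhi (L177 (1 / 3)) 1 = 83 ∧
    invPhi (L177 (1 / 3)) (-(1 / 3)) = 81 ∧
    ∀ α : ℂ, α ≠ 0 → α ≠ 1 → α ≠ -(1 / 3) → invPhi (L177 (1 / 3)) α = 80 := by
  have ha : (1 / 3 : ℂ) ≠ 0 := by norm_num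
  refine ⟨?_, ?_, ?_, fun α h0 h1 h2 => ?_⟩
  · rw [invPhi_zero ha]
    norm_num
  · rw [invPhi_of_ne_zero ha one_ne_zero]
    norm_num
  · rw [invPhi_of_ne_zero ha (neg_ne_zero.mpr ha)]
    norm_num
  · rw [invPhi_of_ne_zero ha h0, if_neg (fun h => h2 (by linear_combination h)),
      if_neg (fun h => h1 h.1), if_neg h1, if_neg (fun h => h1 (by linear_combination 3 / 2 * h))]

theorem sqrt_seven_sq : ((Real.sqrt 7 : ℝ) : ℂ) ^ 2 = 7 := by
  rw [← Complex.ofReal_pow, Real.sq_sqrt (by norm_num)]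
  norm_num

/-- The numbers `1/4 ± (√7/4) i` are the roots of `2 a² - a + 1`, that is, the `a` for which the two
exceptional arguments `-a` and `(1 - a) / (2 a)` coincide. -/
theorem eq_or_eq_iff_quadratic (a : ℂ) :
    (a = 1 / 4 + ((Real.sqrt 7 : ℝ) : ℂ) / 4 * Complex.I ∨
      a = 1 / 4 - ((Real.sqrt 7 : ℝ) : ℂ) / 4 * Complex.I) ↔ 2 * a * -a = 1 - a := by
  have h : 1 - a - 2 * a * -a = 2 * ((a - (1 / 4 + ((Real.sqrt 7 : ℝ) : ℂ) / 4 * Complex.I)) *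
      (a - (1 / 4 - ((Real.sqrt 7 : ℝ) : ℂ) / 4 * Complex.I))) := by
    linear_combination (1 / 8 : ℂ) * Complex.I ^ 2 * sqrt_seven_sq + 7 / 8 * Complex.I_sq
  rw [eq_comm (a := 2 * a * -a), ← sub_eq_zero (a := 1 - a), h, mul_eq_zero, mul_eq_zero,
    sub_eq_zero, sub_eq_zero]
  simp

theorem invPhi_quadratic_values {a : ℂ} (h : 2 * a * -a = 1 - a) :
    invPhi (L177 a) 0 = 104 ∧ invPhi (L177 a) 1 = 82 ∧ invPhi (L177 a) (-a) = 82 ∧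
      ∀ α : ℂ, α ≠ 0 → α ≠ 1 → α ≠ -a → invPhi (L177 a) α = 80 := by
  have ha : a ≠ 0 := by
    rintro rfl
    norm_num at h
  have ha1 : a ≠ 1 := by
    rintro rfl
    norm_num at h
  have ha2 : a ≠ -1 := by
    rintro rfl
    norm_num at h
  have ha3 : 2 * a ≠ 1 - a := fun e => by
    have e' : a = 1 / 3 := by linear_combination e / 3
    rw [e'] at h
    norm_num at h
  refine ⟨?_, ?_, ?_, fun α h0 h1 h2 => ?_⟩
  · rw [invPhi_zero ha, if_neg ha1]
  · rw [invPhi_of_ne_zero ha one_ne_zero, if_neg (fun h => ha2 (by linear_combination h)),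
      if_neg (fun h => ha1 h.2), if_pos rfl, if_neg (by rwa [mul_one])]
  · rw [invPhi_of_ne_zero ha (neg_ne_zero.mpr ha), if_pos (neg_add_cancel a),
      if_neg (fun h => ha1 h.2), if_neg (fun h => ha2 (by linear_combination -h)), if_pos h]
  · rw [invPhi_of_ne_zero ha h0, if_neg (fun h => h2 (by linear_combination h)),
      if_neg (fun h => ha1 h.2), if_neg h1, if_neg]
    intro e
    exact h2 (mul_left_cancel₀ (mul_ne_zero two_ne_zero ha) (e.trans h.symm))

theorem invPhi_generic_values {a : ℂ} (ha : a ≠ 0) (ha1 : a ≠ 1) (ha2 : a ≠ -1)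
    (ha3 : a ≠ 1 / 3) (h : 2 * a * -a ≠ 1 - a) :
    invPhi (L177 a) 0 = 104 ∧ invPhi (L177 a) 1 = 82 ∧ invPhi (L177 a) (-a) = 81 ∧
      invPhi (L177 a) (-(1 / 2) + 1 / (2 * a)) = 81 ∧
      ∀ α : ℂ, α ≠ 0 → α ≠ 1 → α ≠ -a → α ≠ -(1 / 2) + 1 / (2 * a) → invPhi (L177 a) α = 80 := by
  have ha4 : 2 * a ≠ 0 := mul_ne_zero two_ne_zero ha
  have hb : 2 * a * (-(1 / 2) + 1 / (2 * a)) = 1 - a := by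
    field_simp
    ring
  have hb1 : -(1 / 2) + 1 / (2 * a) ≠ 1 := fun e => by
    rw [e] at hb
    exact ha3 (by linear_combination hb / 3)
  have hb0 : -(1 / 2) + 1 / (2 * a) ≠ 0 := fun e => by
    rw [e] at hb
    exact ha1 (by linear_combination hb)
  refine ⟨?_, ?_, ?_, ?_, fun α h0 h1 h2 h3 => ?_⟩
  · rw [invPhi_zero ha, if_neg ha1]
  · rw [invPhi_of_ne_zero ha one_ne_zero, if_neg (fun h => ha2 (by linear_combination h)),
      if_neg (fun h => ha1 h.2), if_pos rfl, if_neg]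
    exact fun e => ha3 (by linear_combination e / 3)
  · rw [invPhi_of_ne_zero ha (neg_ne_zero.mpr ha), if_pos (neg_add_cancel a),
      if_neg (fun h => ha1 h.2), if_neg (fun h => ha2 (by linear_combination -h)), if_neg h]
  · rw [invPhi_of_ne_zero ha hb0, if_neg, if_neg (fun h => ha1 h.2), if_neg hb1, if_pos hb]
    exact fun e => h (by rw [← eq_neg_of_add_eq_zero_left e, hb])
  · rw [invPhi_of_ne_zero ha h0, if_neg (fun h => h2 (by linear_combination h)),
      if_neg (fun h => ha1 h.2), if_neg h1, if_neg]
    exact fun e => h3 (mul_left_cancel₀ ha4 (e.trans hb.symm))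

end L177

/-! ### The Pauli basis of `sl(3, ℂ)` -/

section PauliBasis

attribute [local instance 100] LieRing.ofAssociativeRing

theorem pauliOmega_geom_sum : pauliOmega ^ 2 + pauliOmega + 1 = 0 := by
  have h := (Complex.isPrimitiveRoot_exp 3 three_ne_zero).geom_sum_eq_zero (by norm_num)
  simp only [Finset.sum_range_succ, Finset.sum_range_zero, Nat.cast_ofNat] at h
  rw [pauliOmega]
  linear_combination h

theorem pauliOmega_pow_three : pauliOmega ^ 3 = 1 := by
  linear_combination (pauliOmega - 1) * pauliOmega_geom_sum

theorem pauliOmega_ne_one : pauliOmega - 1 ≠ 0 := fun h => by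
  have h' : pauliOmega = 1 := sub_eq_zero.mp h
  have := pauliOmega_geom_sum
  rw [h'] at this
  norm_num at this

theorem pauliOmega_sq_ne_one : pauliOmega ^ 2 - 1 ≠ 0 := fun h => by
  refine pauliOmega_ne_one ?_
  linear_combination pauliOmega_pow_three - pauliOmega * h

/-- The matrix `Q ^ r * P ^ s`. -/
noncomputable def pauliMatrix (k : PauliIndex) : Matrix (Fin 3) (Fin 3) ℂ :=
  pauliQ ^ k.1.val * pauliP ^ k.2.val

theorem pauliQ_pow_three : pauliQ ^ 3 = 1 := by
  rw [pauliQ, Matrix.diagonal_pow, ← Matrix.diagonal_one]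
  congr 1
  funext i
  fin_cases i
  · simp
  · exact pauliOmega_pow_three
  · change (pauliOmega ^ 2) ^ 3 = 1
    rw [← pow_mul, mul_comm, pow_mul, pauliOmega_pow_three, one_pow]

theorem pauliP_sq : pauliP ^ 2 = !![0, 0, 1; 1, 0, 0; 0, 1, 0] := by
  rw [pow_two, pauliP]
  ext i j
  fin_cases i <;> fin_cases j <;> simp [Matrix.mul_apply, Fin.sum_univ_three]

theorem pauliP_pow_three : pauliP ^ 3 = 1 := by
  rw [pow_succ, pauliP_sq, pauliP]
  ext i j
  fin_cases i <;> fin_cases j <;> simp [Matrix.mul_apply, Fin.sum_univ_three]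

theorem pauliP_mul_pauliQ : pauliP * pauliQ = pauliOmega • (pauliQ * pauliP) := by
  ext i j
  rw [pauliQ, Matrix.mul_diagonal, Matrix.smul_apply, Matrix.diagonal_mul]
  fin_cases i <;> fin_cases j <;> simp [pauliP, pow_two]
  linear_combination -pauliOmega_pow_three

theorem pauliP_mul_pauliQ_pow (n : ℕ) :
    pauliP * pauliQ ^ n = pauliOmega ^ n • (pauliQ ^ n * pauliP) := by
  induction n with
  | zero => simp
  | succ n ih =>
    rw [pow_succ pauliQ, ← mul_assoc, ih, smul_mul_assoc, mul_assoc, pauliP_mul_pauliQ,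
      mul_smul_comm, smul_smul, ← pow_succ, mul_assoc]

theorem pauliP_pow_mul_pauliQ_pow (m n : ℕ) :
    pauliP ^ m * pauliQ ^ n = pauliOmega ^ (m * n) • (pauliQ ^ n * pauliP ^ m) := by
  induction m with
  | zero => simp
  | succ m ih =>
    rw [pow_succ', mul_assoc, ih, mul_smul_comm, ← mul_assoc, pauliP_mul_pauliQ_pow,
      smul_mul_assoc, smul_smul, ← pow_add, mul_assoc]
    congr 2
    ring

theorem pauliMatrix_mul (j k : PauliIndex) : pauliMatrix j * pauliMatrix k =
    pauliOmega ^ (j.2.val * k.1.val) • pauliMatrix (j + k) := by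
  have hQ : pauliQ ^ (j + k).1.val = pauliQ ^ j.1.val * pauliQ ^ k.1.val := by
    rw [Prod.fst_add, ZMod.val_add, ← pow_eq_pow_mod _ pauliQ_pow_three, pow_add]
  have hP : pauliP ^ (j + k).2.val = pauliP ^ j.2.val * pauliP ^ k.2.val := by
    rw [Prod.snd_add, ZMod.val_add, ← pow_eq_pow_mod _ pauliP_pow_three, pow_add]
  simp only [pauliMatrix, hQ, hP]
  rw [mul_assoc, ← mul_assoc (pauliP ^ j.2.val), pauliP_pow_mul_pauliQ_pow, smul_mul_assoc,
    mul_smul_comm]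
  simp only [mul_assoc]

/-- The matrices `Q ^ r * P ^ s`, `(r, s) ≠ (0, 0)`, entry by entry. -/
noncomputable def pauliEntries : Fin 8 → Matrix (Fin 3) (Fin 3) ℂ :=
  ![!![0, 1, 0; 0, 0, 1; 1, 0, 0],
    !![0, 0, 1; 1, 0, 0; 0, 1, 0],
    !![1, 0, 0; 0, pauliOmega, 0; 0, 0, pauliOmega ^ 2],
    !![1, 0, 0; 0, pauliOmega ^ 2, 0; 0, 0, pauliOmega],
    !![0, 1, 0; 0, 0, pauliOmega; pauliOmega ^ 2, 0, 0],
    !![0, 0, 1; pauliOmega ^ 2, 0, 0; 0, pauliOmega, 0],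
    !![0, 0, 1; pauliOmega, 0, 0; 0, pauliOmega ^ 2, 0],
    !![0, 1, 0; 0, 0, pauliOmega ^ 2; pauliOmega, 0, 0]]

theorem pauliMatrix_label (i : Fin 8) : pauliMatrix (L177.label i) = pauliEntries i := by
  have h4 : (pauliOmega ^ 2) ^ 2 = pauliOmega := by
    linear_combination pauliOmega * pauliOmega_pow_three
  have hQ : pauliQ = Matrix.diagonal ![1, pauliOmega, pauliOmega ^ 2] := rfl
  have hQ2 : pauliQ ^ 2 = Matrix.diagonal ![1, pauliOmega ^ 2, pauliOmega] := by
    rw [hQ, Matrix.diagonal_pow]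
    congr 1
    funext i
    fin_cases i <;> simp [h4]
  have hP : pauliP = !![0, 1, 0; 0, 0, 1; 1, 0, 0] := rfl
  fin_cases i
  · change pauliQ ^ 0 * pauliP ^ 1 = pauliEntries 0
    rw [pow_zero, one_mul, pow_one]
    rfl
  · change pauliQ ^ 0 * pauliP ^ 2 = pauliEntries 1
    rw [pow_zero, one_mul, pauliP_sq]
    rfl
  · change pauliQ ^ 1 * pauliP ^ 0 = pauliEntries 2
    rw [pow_zero, mul_one, pow_one, hQ]
    ext i j
    fin_cases i <;> fin_cases j <;> simp [pauliEntries]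
  · change pauliQ ^ 2 * pauliP ^ 0 = pauliEntries 3
    rw [pow_zero, mul_one, hQ2]
    ext i j
    fin_cases i <;> fin_cases j <;> simp [pauliEntries]
  · change pauliQ ^ 1 * pauliP ^ 1 = pauliEntries 4
    rw [pow_one, pow_one, hQ, hP]
    ext i j
    rw [Matrix.diagonal_mul]
    fin_cases i <;> fin_cases j <;> simp [pauliEntries]
  · change pauliQ ^ 2 * pauliP ^ 2 = pauliEntries 5
    rw [hQ2, pauliP_sq]
    ext i j
    rw [Matrix.diagonal_mul]
    fin_cases i <;> fin_cases j <;> simp [pauliEntries]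
  · change pauliQ ^ 1 * pauliP ^ 2 = pauliEntries 6
    rw [pow_one, hQ, pauliP_sq]
    ext i j
    rw [Matrix.diagonal_mul]
    fin_cases i <;> fin_cases j <;> simp [pauliEntries]
  · change pauliQ ^ 2 * pauliP ^ 1 = pauliEntries 7
    rw [hQ2, pow_one, hP]
    ext i j
    rw [Matrix.diagonal_mul]
    fin_cases i <;> fin_cases j <;> simp [pauliEntries]

theorem trace_pauliEntries (i : Fin 8) : (pauliEntries i).trace = 0 := by
  have h := pauliOmega_geom_sum
  rw [Matrix.trace_fin_three]
  fin_cases i <;> simp [pauliEntries] <;> linear_combination h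

/-- The basis vectors `Q ^ r * P ^ s` of `sl(3, ℂ)`, numbered in the same way as the basis vectors
of `𝓛₁₇,₇(a)`. -/
noncomputable def pauliVec (i : Fin 8) : LieAlgebra.SpecialLinear.sl (Fin 3) ℂ :=
  ⟨pauliEntries i, trace_pauliEntries i⟩

theorem sum_smul_pauliVec (v : Fin 8 → ℂ) : (∑ i, v i • pauliVec i).1 =
    !![v 2 + v 3, v 0 + v 4 + v 7, v 1 + v 5 + v 6;
      v 1 + pauliOmega ^ 2 * v 5 + pauliOmega * v 6, pauliOmega * v 2 + pauliOmega ^ 2 * v 3,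
        v 0 + pauliOmega * v 4 + pauliOmega ^ 2 * v 7;
      v 0 + pauliOmega ^ 2 * v 4 + pauliOmega * v 7, v 1 + pauliOmega * v 5 + pauliOmega ^ 2 * v 6,
        pauliOmega ^ 2 * v 2 + pauliOmega * v 3] := by
  rw [Fin.sum_univ_eight]
  change v 0 • pauliEntries 0 + v 1 • pauliEntries 1 + v 2 • pauliEntries 2 + v 3 • pauliEntries 3
    + v 4 • pauliEntries 4 + v 5 • pauliEntries 5 + v 6 • pauliEntries 6 + v 7 • pauliEntries 7 = _
  ext i j
  fin_cases i <;> fin_cases j <;> simp [pauliEntries] <;> ring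

/-- The coordinates in the basis `Q ^ r * P ^ s`: the coefficient of `Q ^ r * P ^ s` in `x` is
`1/3 ∑ₗ ω ^ (-r l) x_{l, l + s}`. -/
noncomputable def pauliCoord :
    LieAlgebra.SpecialLinear.sl (Fin 3) ℂ ≃ₗ[ℂ] (Fin 8 → ℂ) where
  toFun x :=
    ![(x.1 0 1 + x.1 1 2 + x.1 2 0) / 3,
      (x.1 0 2 + x.1 1 0 + x.1 2 1) / 3,
      (x.1 0 0 + pauliOmega ^ 2 * x.1 1 1 + pauliOmega * x.1 2 2) / 3,
      (x.1 0 0 + pauliOmega * x.1 1 1 + pauliOmega ^ 2 * x.1 2 2) / 3,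
      (x.1 0 1 + pauliOmega ^ 2 * x.1 1 2 + pauliOmega * x.1 2 0) / 3,
      (x.1 0 2 + pauliOmega * x.1 1 0 + pauliOmega ^ 2 * x.1 2 1) / 3,
      (x.1 0 2 + pauliOmega ^ 2 * x.1 1 0 + pauliOmega * x.1 2 1) / 3,
      (x.1 0 1 + pauliOmega * x.1 1 2 + pauliOmega ^ 2 * x.1 2 0) / 3]
  map_add' x y := by
    funext i
    fin_cases i <;> simp <;> ring
  map_smul' c x := by
    funext i
    fin_cases i <;> simp <;> ring
  invFun v := ∑ i, v i • pauliVec i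
  left_inv x := by
    have hw := pauliOmega_geom_sum
    have hx : x.1 0 0 + x.1 1 1 + x.1 2 2 = 0 := by
      rw [← Matrix.trace_fin_three]
      exact x.2
    apply Subtype.ext
    rw [sum_smul_pauliVec]
    ext i j
    fin_cases i <;> fin_cases j <;>
      simp only [Fin.mk_zero', Fin.mk_one, Fin.reduceFinMk, Matrix.of_apply, ↓Matrix.cons_val] <;>
      grind
  right_inv v := by
    have hw := pauliOmega_geom_sum
    funext i
    simp only [sum_smul_pauliVec]
    fin_cases i <;>
      simp only [Fin.mk_zero', Fin.mk_one, Fin.reduceFinMk, Matrix.of_apply, ↓Matrix.cons_val] <;>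
      grind

theorem pauliCoord_pauliVec (i : Fin 8) : pauliCoord (pauliVec i) = Pi.single i 1 := by
  have h : pauliVec i = pauliCoord.symm (Pi.single i 1) := by
    change _ = ∑ j, (Pi.single i 1 : Fin 8 → ℂ) j • pauliVec j
    simp [Pi.single_apply]
  rw [h, LinearEquiv.apply_symm_apply]

theorem exists_label_eq {k : PauliIndex} (hk : k ≠ 0) : ∃ i, L177.label i = k := by
  revert k
  decide

theorem label_ne_zero (i : Fin 8) : L177.label i ≠ 0 := by
  revert i
  decide

theorem label_injective : Function.Injective L177.label := by
  intro i j
  revert i j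
  decide

theorem pauliComponent_zero : pauliComponent 0 = ⊥ := by
  rw [eq_bot_iff]
  intro x hx
  obtain ⟨c, hc⟩ := Submodule.mem_span_singleton.mp (Submodule.mem_comap.mp hx)
  have h1 : pauliMatrix 0 = 1 := by simp [pauliMatrix]
  have hc' : c • (1 : Matrix (Fin 3) (Fin 3) ℂ) = x.1 := (congrArg (c • ·) h1).symm.trans hc
  have htr : Matrix.trace x.1 = 0 := x.2
  rw [← hc', Matrix.trace_smul, Matrix.trace_one] at htr
  have h0 : c = 0 := by simpa using htr
  rw [h0, zero_smul] at hc'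
  exact Subtype.ext hc'.symm

theorem pauliComponent_label (i : Fin 8) :
    pauliComponent (L177.label i) = Submodule.span ℂ {pauliVec i} := by
  ext x
  change x.1 ∈ Submodule.span ℂ {pauliMatrix (L177.label i)} ↔ _
  rw [pauliMatrix_label, Submodule.mem_span_singleton, Submodule.mem_span_singleton]
  exact exists_congr fun c => ⟨fun h => Subtype.ext h, fun h => congrArg Subtype.val h⟩

/-- The commutation relations `[Q ^ r P ^ s, Q ^ r' P ^ s'] =
(ω ^ (s r') - ω ^ (s' r)) Q ^ (r + r') P ^ (s + s')`. -/
theorem lie_pauliVec {i j l : Fin 8} (h : L177.label i + L177.label j = L177.label l) :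
    ⁅pauliVec i, pauliVec j⁆ =
      (pauliOmega ^ ((L177.label i).2.val * (L177.label j).1.val)
        - pauliOmega ^ ((L177.label j).2.val * (L177.label i).1.val)) • pauliVec l := by
  apply Subtype.ext
  rw [LieAlgebra.SpecialLinear.sl_bracket]
  change pauliEntries i * pauliEntries j - pauliEntries j * pauliEntries i = _ • pauliEntries l
  rw [← pauliMatrix_label, ← pauliMatrix_label, ← pauliMatrix_label, pauliMatrix_mul,
    pauliMatrix_mul, add_comm (L177.label j), h, sub_smul]

end PauliBasis

namespace L177

/-! ### `𝓛₁₇,₇(a)` is nilpotent and a graded contraction of `sl(3, ℂ)` -/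

theorem finrank_eq_eight (a : ℂ) : Module.finrank ℂ (L177 a) = 8 := by
  rw [Module.finrank_eq_card_basis (basis a), Fintype.card_fin]

/-- A threefold bracket `[x, [x, [x, v]]]` vanishes, so that the algebra is nilpotent by Engel's
theorem. -/
theorem isNilpotent (a : ℂ) : LieRing.IsNilpotent (L177 a) := by
  rw [LieAlgebra.isNilpotent_iff_forall (R := ℂ)]
  intro x
  refine ⟨3, LinearMap.ext fun v => ?_⟩
  change bracket a x (bracket a x (bracket a x v)) = 0
  funext i
  fin_cases i <;> simp [bracket, minor]

theorem component_zero (a : ℂ) : component a 0 = ⊥ := by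
  rw [component, Submodule.span_eq_bot]
  rintro v ⟨i, hi, -⟩
  exact absurd hi (label_ne_zero i)

theorem component_label (a : ℂ) (i : Fin 8) :
    component a (label i) = Submodule.span ℂ {basis a i} := by
  rw [component]
  congr 1
  ext v
  rw [Set.mem_ofPred_eq, Set.mem_singleton_iff, basis_apply]
  constructor
  · rintro ⟨j, hj, rfl⟩
    rw [label_injective hj]
  · rintro rfl
    exact ⟨i, rfl, rfl⟩

/-- The number of the basis vector with a given label; the value at `(0, 0)` is irrelevant. -/
def unlabel (k : PauliIndex) : Fin 8 :=
  if k = (0, 1) then 0 else if k = (0, 2) then 1 else if k = (1, 0) then 2 else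
  if k = (2, 0) then 3 else if k = (1, 1) then 4 else if k = (2, 2) then 5 else
  if k = (1, 2) then 6 else 7

theorem unlabel_label (i : Fin 8) : unlabel (label i) = i := by
  revert i
  decide

/-- The contraction parameters: the quotients of the structure constants of `𝓛₁₇,₇(a)` by those of
`sl(3, ℂ)`. -/
noncomputable def contraction (a : ℂ) : Fin 8 → Fin 8 → ℂ :=
  ![![0, 0, -a / (pauliOmega - 1), 1 / (pauliOmega ^ 2 - 1), 1 / (pauliOmega - 1),
      1 / (pauliOmega ^ 2 - 1), 0, 0],
    ![0, 0, 1 / (pauliOmega ^ 2 - 1), 0, 0, 1 / (pauliOmega - 1), 0, 0],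
    ![-a / (pauliOmega - 1), 1 / (pauliOmega ^ 2 - 1), 0, 0, 1 / (1 - pauliOmega), 0, 0, 0],
    ![1 / (pauliOmega ^ 2 - 1), 0, 0, 0, 0, 0, 0, 0],
    ![1 / (pauliOmega - 1), 0, 1 / (1 - pauliOmega), 0, 0, 0, 0, 0],
    ![1 / (pauliOmega ^ 2 - 1), 1 / (pauliOmega - 1), 0, 0, 0, 0, 0, 0],
    0,
    0]

theorem contraction_comm (a : ℂ) (i j : Fin 8) : contraction a i j = contraction a j i := by
  fin_cases i <;> fin_cases j <;> rfl

/-- The graded linear isomorphism from `sl(3, ℂ)` onto `𝓛₁₇,₇(a)`. -/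
noncomputable def pauliEquiv (a : ℂ) : LieAlgebra.SpecialLinear.sl (Fin 3) ℂ ≃ₗ[ℂ] L177 a :=
  pauliCoord.trans (coord a).symm

theorem pauliEquiv_pauliVec (a : ℂ) (i : Fin 8) : pauliEquiv a (pauliVec i) = basis a i := by
  apply (coord a).injective
  rw [coord_basis, ← pauliCoord_pauliVec]
  exact (coord a).apply_symm_apply _

theorem lie_basis (a : ℂ) (i j m : Fin 8) : coord a ⁅basis a i, basis a j⁆ m =
    atLie a (fun l => coord a (basis a l) m) i j :=
  map_lie_basis ((LinearMap.proj m).comp (coord a).toLinearMap) i j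

theorem lie_basis_of_lt (a : ℂ) {i j : Fin 8} (hij : i < j) : ⁅basis a i, basis a j⁆ =
    contraction a i j • pauliEquiv a ⁅pauliVec i, pauliVec j⁆ := by
  have h1 := pauliOmega_ne_one
  have h2 := pauliOmega_sq_ne_one
  have h3 : 1 - pauliOmega ≠ 0 := fun h => h1 (by linear_combination -h)
  have h4 : pauliOmega ^ 4 = pauliOmega := by
    linear_combination pauliOmega * pauliOmega_pow_three
  have hl : ∀ (l : Fin 8) (c : ℂ), label i + label j = label l →
      contraction a i j * (pauliOmega ^ ((label i).2.val * (label j).1.val)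
        - pauliOmega ^ ((label j).2.val * (label i).1.val)) = c →
      (∀ m, atLie a (fun l => coord a (basis a l) m) i j = c * coord a (basis a l) m) →
      ⁅basis a i, basis a j⁆ = contraction a i j • pauliEquiv a ⁅pauliVec i, pauliVec j⁆ := by
    intro l c h hc hb
    rw [lie_pauliVec h, map_smul, pauliEquiv_pauliVec, smul_smul, hc]
    apply (coord a).injective
    ext m
    rw [lie_basis, hb, map_smul, Pi.smul_apply, smul_eq_mul]
  have h0 : contraction a i j = 0 → (∀ m, atLie a (fun l => coord a (basis a l) m) i j = 0) →
      ⁅basis a i, basis a j⁆ = contraction a i j • pauliEquiv a ⁅pauliVec i, pauliVec j⁆ := by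
    intro h hb
    rw [h, zero_smul]
    apply (coord a).injective
    ext m
    rw [lie_basis, hb, map_zero, Pi.zero_apply]
  fin_cases i <;> fin_cases j <;> first
    | exact absurd hij (by decide)
    | exact h0 rfl fun m => rfl
    | skip
  · refine hl 4 (-a) (by decide) ?_ fun m => rfl
    change -a / (pauliOmega - 1) * (pauliOmega ^ 1 - pauliOmega ^ 0) = -a
    rw [pow_one, pow_zero, div_mul_cancel₀ _ h1]
  · refine hl 7 1 (by decide) ?_ fun m => (one_mul _).symm
    change 1 / (pauliOmega ^ 2 - 1) * (pauliOmega ^ 2 - pauliOmega ^ 0) = 1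
    rw [pow_zero, div_mul_cancel₀ _ h2]
  · refine hl 6 1 (by decide) ?_ fun m => (one_mul _).symm
    change 1 / (pauliOmega - 1) * (pauliOmega ^ 1 - pauliOmega ^ 0) = 1
    rw [pow_one, pow_zero, div_mul_cancel₀ _ h1]
  · refine hl 3 1 (by decide) ?_ fun m => (one_mul _).symm
    change 1 / (pauliOmega ^ 2 - 1) * (pauliOmega ^ 2 - pauliOmega ^ 0) = 1
    rw [pow_zero, div_mul_cancel₀ _ h2]
  · refine hl 6 1 (by decide) ?_ fun m => (one_mul _).symm
    change 1 / (pauliOmega ^ 2 - 1) * (pauliOmega ^ 2 - pauliOmega ^ 0) = 1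
    rw [pow_zero, div_mul_cancel₀ _ h2]
  · refine hl 7 1 (by decide) ?_ fun m => (one_mul _).symm
    change 1 / (pauliOmega - 1) * (pauliOmega ^ 4 - pauliOmega ^ 0) = 1
    rw [h4, pow_zero, div_mul_cancel₀ _ h1]
  · refine hl 7 1 (by decide) ?_ fun m => (one_mul _).symm
    change 1 / (1 - pauliOmega) * (pauliOmega ^ 0 - pauliOmega ^ 1) = 1
    rw [pow_one, pow_zero, div_mul_cancel₀ _ h3]

theorem lie_basis_eq (a : ℂ) (i j : Fin 8) : ⁅basis a i, basis a j⁆ =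
    contraction a i j • pauliEquiv a ⁅pauliVec i, pauliVec j⁆ := by
  rcases lt_trichotomy i j with h | rfl | h
  · exact lie_basis_of_lt a h
  · rw [lie_self, lie_self, map_zero, smul_zero]
  · rw [← lie_skew, lie_basis_of_lt a h, ← lie_skew (pauliVec i), map_neg, smul_neg,
      contraction_comm]

theorem isPauliGradedContraction (a : ℂ) : IsPauliGradedContraction (L177 a) (component a) := by
  refine ⟨fun j k => contraction a (unlabel j) (unlabel k), pauliEquiv a,
    fun j k => contraction_comm a _ _, fun k => ?_, fun j k x hx y hy => ?_⟩
  · by_cases hk : k = 0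
    · rw [hk, pauliComponent_zero, component_zero, Submodule.map_bot]
    · obtain ⟨i, rfl⟩ := exists_label_eq hk
      rw [pauliComponent_label, component_label, Submodule.map_span, Set.image_singleton]
      exact congrArg (fun v => Submodule.span ℂ {v}) (pauliEquiv_pauliVec a i)
  · by_cases hj : j = 0
    · rw [hj, pauliComponent_zero, Submodule.mem_bot] at hx
      rw [hx, zero_lie, map_zero, zero_lie, smul_zero]
    by_cases hk : k = 0
    · rw [hk, pauliComponent_zero, Submodule.mem_bot] at hy
      rw [hy, lie_zero, map_zero, lie_zero, smul_zero]
    obtain ⟨i, rfl⟩ := exists_label_eq hj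
    obtain ⟨l, rfl⟩ := exists_label_eq hk
    rw [pauliComponent_label, Submodule.mem_span_singleton] at hx hy
    obtain ⟨c, rfl⟩ := hx
    obtain ⟨d, rfl⟩ := hy
    change _ = contraction a (unlabel (label i)) (unlabel (label l)) • _
    rw [unlabel_label, unlabel_label, map_smul, map_smul, smul_lie, lie_smul, smul_lie, lie_smul,
      pauliEquiv_pauliVec, pauliEquiv_pauliVec, lie_basis_eq, map_smul, map_smul,
      smul_smul, smul_smul, smul_smul, smul_smul]
    congr 1
    ring

end L177

theorem mainTheorem9 :
    -- each `𝓛₁₇,₇(a)`, `a ≠ 0`, is an eight-dimensional nilpotent graded contraction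
    (∀ a : ℂ, a ≠ 0 →
      Module.finrank ℂ (L177 a) = 8 ∧
      LieRing.IsNilpotent (L177 a) ∧
      IsPauliGradedContraction (L177 a) (L177.component a)) ∧
    -- the function `ψ`, which does not depend on `a`
    (∀ a : ℂ, a ≠ 0 →
      invPsi (L177 a) 0 = 20 ∧
      invPsi (L177 a) 1 = 19 ∧
      ∀ α : ℂ, α ≠ 0 → α ≠ 1 → invPsi (L177 a) α = 18) ∧
    (∀ a a' : ℂ, a ≠ 0 → a' ≠ 0 → invPsi (L177 a) = invPsi (L177 a')) ∧
    -- the function `φ` for `a = 1`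
    (invPhi (L177 1) 0 = 112 ∧ invPhi (L177 1) 1 = 83 ∧ invPhi (L177 1) (-1) = 81 ∧
      ∀ α : ℂ, α ≠ 0 → α ≠ 1 → α ≠ -1 → invPhi (L177 1) α = 80) ∧
    -- the function `φ` for `a = -1`
    (invPhi (L177 (-1)) 0 = 104 ∧ invPhi (L177 (-1)) 1 = 83 ∧ invPhi (L177 (-1)) (-1) = 81 ∧
      ∀ α : ℂ, α ≠ 0 → α ≠ 1 → α ≠ -1 → invPhi (L177 (-1)) α = 80) ∧
    -- the function `φ` for `a = 1/4 ± (√7/4) i`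
    (∀ a : ℂ, a = 1 / 4 + ((Real.sqrt 7 : ℝ) : ℂ) / 4 * Complex.I ∨
        a = 1 / 4 - ((Real.sqrt 7 : ℝ) : ℂ) / 4 * Complex.I →
      invPhi (L177 a) 0 = 104 ∧ invPhi (L177 a) 1 = 82 ∧ invPhi (L177 a) (-a) = 82 ∧
      ∀ α : ℂ, α ≠ 0 → α ≠ 1 → α ≠ -a → invPhi (L177 a) α = 80) ∧
    -- the function `φ` for `a = 1/3`
    (invPhi (L177 (1 / 3)) 0 = 104 ∧ invPhi (L177 (1 / 3)) 1 = 83 ∧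
      invPhi (L177 (1 / 3)) (-(1 / 3)) = 81 ∧
      ∀ α : ℂ, α ≠ 0 → α ≠ 1 → α ≠ -(1 / 3) → invPhi (L177 (1 / 3)) α = 80) ∧
    -- the function `φ` for all other `a`
    (∀ a : ℂ, a ≠ 0 → a ≠ 1 → a ≠ -1 → a ≠ 1 / 3 →
        a ≠ 1 / 4 + ((Real.sqrt 7 : ℝ) : ℂ) / 4 * Complex.I →
        a ≠ 1 / 4 - ((Real.sqrt 7 : ℝ) : ℂ) / 4 * Complex.I →
      invPhi (L177 a) 0 = 104 ∧ invPhi (L177 a) 1 = 82 ∧ invPhi (L177 a) (-a) = 81 ∧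
      invPhi (L177 a) (-(1 / 2) + 1 / (2 * a)) = 81 ∧
      ∀ α : ℂ, α ≠ 0 → α ≠ 1 → α ≠ -a → α ≠ -(1 / 2) + 1 / (2 * a) →
        invPhi (L177 a) α = 80) ∧
    -- the function `φ` determines `a`
    (∀ a a' : ℂ, a ≠ 0 → a' ≠ 0 → invPhi (L177 a) = invPhi (L177 a') → a = a') ∧
    -- in particular the algebras are pairwise non-isomorphic
    (∀ a a' : ℂ, a ≠ 0 → a' ≠ 0 → Nonempty (L177 a ≃ₗ⁅ℂ⁆ L177 a') → a = a') := by
  refine ⟨fun a _ => ⟨L177.finrank_eq_eight a, L177.isNilpotent a, L177.isPauliGradedContraction a⟩,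
    fun a ha => ⟨?_, ?_, fun t h0 h1 => ?_⟩, fun a a' ha ha' => ?_, L177.invPhi_one_values,
    L177.invPhi_neg_one_values,
    fun a h => L177.invPhi_quadratic_values ((L177.eq_or_eq_iff_quadratic a).mp h),
    L177.invPhi_third_values, fun a ha h1 h2 h3 h4 h5 => ?_,
    fun a a' ha ha' => L177.invPhi_injective ha ha',
    fun a a' ha ha' ⟨f⟩ => L177.eq_of_equiv ha ha' f⟩
  · simp [L177.invPsi_eq ha]
  · simp [L177.invPsi_eq ha]
  · simp [L177.invPsi_eq ha, h0, h1]
  · funext t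
    rw [L177.invPsi_eq ha, L177.invPsi_eq ha']
  · exact L177.invPhi_generic_values ha h1 h2 h3
      fun h => ((L177.eq_or_eq_iff_quadratic a).mpr h).elim h4 h5
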